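/- Let $k$ be an algebraically closed field and let $n\ge 1$ be an integer that is nonzero in $k$. Let $\rho_1,\dots,\rho_r\in k$ be distinct, let $l_1,\dots,l_r$ be nonnegative integers with $n\mid \sum_i l_i$, and let $f(x)=\prod_{i=1}^r (x-\rho_i)^{l_i}$. Let $F=k(x)(y)$ be a field extension of $k(x)$ of degree $n$ with $y^n=f(x)$, and let $X$ be the smooth projective curve over $k$ with function field $F$, with the covering $\pi:X\to\mathbb P^1$ given by $x$. Put $U_0=X\setminus\pi^{-1}(0)$ and $U_\infty=X\setminus\pi^{-1}(\infty)$, and let $$H^1_{dR}(X/k)=\frac{\{(\omega_0,\omega_\infty,h)\in\Omega_X(U_0)\times\Omega_X(U_\infty)\times\mathcal O_X(U_0\cap U_\infty)\;:\; dh=\omega_0-\omega_\infty\}}{\{(dh_0,dh_\infty,h_0-h_\infty)\;:\; h_0\in\mathcal O_X(U_0),\ h_\infty\in\mathcal O_X(U_\infty)\}}$$ be the first de Rham cohomology in its Čech description for the covering $\{U_0,U_\infty\}$, where functions and differentials are regarded as rational functions and rational differentials on $X$. Put $g_i=\gcd(n,l_i)$, $e_i=n/g_i$, $\lambda_i=l_i/g_i$.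 For $1\le\mu\le n-1$ write $\mu\lambda_i=m_i^{(\mu)}e_i+\upsilon_i^{(\mu)}$ with $0\le\upsilon_i^{(\mu)}\le e_i-1$, and put $$g_\mu(x)=\prod_{i=1}^r (x-\rho_i)^{m_i^{(\mu)}},\qquad t^{(\mu)}=\frac1n\sum_{i=1}^r g_i\upsilon_i^{(\mu)}\in\mathbb Z,\qquad I^{(\mu)}=\{i:\upsilon_i^{(\mu)}\ne 0\},$$ $$\psi_{\mu,\nu}(x)=\sum_{i=1}^r g_i\upsilon_i^{(\mu)}\,x\prod_{j\in I^{(\mu)}\setminus\{i\}}(x-\rho_j)\;-\;\nu n\prod_{i\in I^{(\mu)}}(x-\rho_i).$$ For a polynomial $h$ and $s\in\mathbb N$ let $h^{\le s}$ and $h^{>s}$ be the sums of the monomials of $h$ of degree $\le s$ and $>s$. Consider all pairs $(\mu,\nu)$ with $1\le\mu\le n-1$, $t^{(\mu)}\ge2$ and $1\le\nu\le t^{(\mu)}-1$. For each such pair let $s=s_{\mu,\nu}$ be either $\nu$ or, if $t^{(n-\mu)}\ge 2$, possibly $\nu+1$ (an arbitrary choice for each pair). Then the triples $$\left(\frac{\psi_{\mu,\nu}^{\le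 s}(x)}{n x^{\nu+1}}\frac{g_{n-\mu}(x)}{y^{n-\mu}}\,dx,\ -\frac{\psi_{\mu,\nu}^{> s}(x)}{n x^{\nu+1}}\frac{g_{n-\mu}(x)}{y^{n-\mu}}\,dx,\ \frac{y^\mu}{x^\nu g_\mu(x)}\right)$$ and $$\left(\frac{x^{\nu-1}g_\mu(x)}{y^\mu}\,dx,\ \frac{x^{\nu-1}g_\mu(x)}{y^\mu}\,dx,\ 0\right)$$ belong to the numerator of the quotient above, and their classes $a_{\mu,\nu}$ and $\delta_{\mu,\nu}$, over all these pairs $(\mu,\nu)$, together form a $k$-basis of $H^1_{dR}(X/k)$. -/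

import Mathlib

open Polynomial
open scoped KaehlerDifferential

noncomputable section

namespace KummerCover

/-! ### Numerical data of the cover `y ^ n = ∏ i, (x - ρ i) ^ l i` -/

section Numerical

variable (n : ℕ) {r : ℕ} (l : Fin r → ℕ)

/-- `g_i = (n, l_i)`, the number of points above `ρ_i`. -/
def numPts (i : Fin r) : ℕ := Nat.gcd n (l i)

/-- `e_i = n / (n, l_i)`, the ramification index above `ρ_i`. -/
def ramIdx (i : Fin r) : ℕ := n / numPts n l i

/-- `λ_i = l_i / (l_i, n)`. -/
def lam (i : Fin r) : ℕ := l i / numPts n l i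

/-- `m_i^{(μ)}`, the quotient of `μ λ_i` by `e_i`. -/
def quo (μ : ℕ) (i : Fin r) : ℕ := μ * lam n l i / ramIdx n l i

/-- `υ_i^{(μ)}`, the remainder of `μ λ_i` modulo `e_i`. -/
def rem (μ : ℕ) (i : Fin r) : ℕ := μ * lam n l i % ramIdx n l i

/-- `t^{(μ)} = (1 / n) ∑ g_i υ_i^{(μ)}`. The division is exact when `n ∣ ∑ l_i`,
see `mul_tt`. -/
def tt (μ : ℕ) : ℕ := (∑ i, numPts n l i * rem n l μ i) / n

/-- `I^{(μ)}`, the set of `i` with `υ_i^{(μ)} ≠ 0`. -/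
def ramSet (μ : ℕ) : Finset (Fin r) := Finset.univ.filter fun i => rem n l μ i ≠ 0

/-- The division in the definition of `t^{(μ)}` is exact. -/
theorem mul_tt (hl : n ∣ ∑ i, l i) (μ : ℕ) :
    n * tt n l μ = ∑ i, numPts n l i * rem n l μ i := by
  refine Nat.mul_div_cancel' ?_
  have key : ∀ i, numPts n l i * rem n l μ i + n * quo n l μ i = μ * l i := by
    intro i
    have h1 : numPts n l i * ramIdx n l i = n := Nat.mul_div_cancel' (Nat.gcd_dvd_left _ _)
    have h2 : numPts n l i * lam n l i = l i := Nat.mul_div_cancel' (Nat.gcd_dvd_right _ _)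
    have h3 : rem n l μ i + ramIdx n l i * quo n l μ i = μ * lam n l i := Nat.mod_add_div _ _
    calc numPts n l i * rem n l μ i + n * quo n l μ i
        = numPts n l i * rem n l μ i + (numPts n l i * ramIdx n l i) * quo n l μ i := by rw [h1]
      _ = numPts n l i * (rem n l μ i + ramIdx n l i * quo n l μ i) := by ring
      _ = μ * (numPts n l i * lam n l i) := by rw [h3]; ring
      _ = μ * l i := by rw [h2]
  have hs : (∑ i, numPts n l i * rem n l μ i) + n * ∑ i, quo n l μ i = μ * ∑ i, l i := by
    rw [Finset.mul_sum, Finset.mul_sum, ← Finset.sum_add_distrib]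
    exact Finset.sum_congr rfl fun i _ => key i
  exact (Nat.dvd_add_left (Dvd.intro _ rfl)).1 (hs ▸ hl.mul_left μ)

/-- The pairs `(μ, ν)` with `1 ≤ μ ≤ n - 1`, `t^{(μ)} ≥ 2` and `1 ≤ ν ≤ t^{(μ)} - 1`. -/
def Idx : Type :=
  {q : ℕ × ℕ // (1 ≤ q.1 ∧ q.1 < n) ∧ 2 ≤ tt n l q.1 ∧ (1 ≤ q.2 ∧ q.2 < tt n l q.1)}

end Numerical

/-! ### The polynomials `f`, `g_μ`, `ψ_{μ,ν}` -/

section Polynomials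

variable {k : Type*} [Field k] (n : ℕ) {r : ℕ} (ρ : Fin r → k) (l : Fin r → ℕ)

/-- `f = ∏ (x - ρ_i) ^ {l_i}`. -/
def ff : k[X] := ∏ i, (X - C (ρ i)) ^ l i

/-- `g_μ = ∏ (x - ρ_i) ^ {m_i^{(μ)}}`. -/
def gg (μ : ℕ) : k[X] := ∏ i, (X - C (ρ i)) ^ quo n l μ i

/-- `ψ_{μ,ν} = ∑_i g_i υ_i^{(μ)} x ∏_{j ∈ I^{(μ)} \ {i}} (x - ρ_j)
  - ν n ∏_{i ∈ I^{(μ)}} (x - ρ_i)`. -/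
def psi (μ ν : ℕ) : k[X] :=
  (∑ i, C ((numPts n l i * rem n l μ i : ℕ) : k) * X *
      ∏ j ∈ (ramSet n l μ).erase i, (X - C (ρ j)))
    - C ((ν * n : ℕ) : k) * ∏ i ∈ ramSet n l μ, (X - C (ρ i))

/-- The sum of the monomials of `h` of degree `≤ m`. -/
def truncLE (h : k[X]) (m : ℕ) : k[X] := ∑ j ∈ h.support with j ≤ m, monomial j (h.coeff j)

/-- The sum of the monomials of `h` of degree `> m`. -/
def truncGT (h : k[X]) (m : ℕ) : k[X] := ∑ j ∈ h.support with m < j, monomial j (h.coeff j)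

end Polynomials

/-! ### The curve and its Čech de Rham cohomology

Let `F` be a function field of one variable over `k` and `x : F`. The curve `X` is the smooth
projective model of `F`, that is, the normalization of the projective line (with coordinate `x`)
in `F`. The preimage in `X` of an affine open set `Spec k[S]` of the line is the spectrum of the
integral closure of `k[S]` in `F`. The set `U_∞` is the preimage of `Spec k[x]`, the set `U_0`
is the preimage of `Spec k[1/x]`, and `U_0 ∩ U_∞` is the preimage of `Spec k[x, 1/x]`. -/

section DeRham

variable (k : Type*) {F : Type*} [Field k] [Field F] [Algebra k F]

/-- The regular functions on the preimage of `Spec k[S]`: the integral closure of `k[S]`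
in the function field. -/
def regFun (S : Set F) : Subalgebra k F :=
  (integralClosure (Algebra.adjoin k S) F).restrictScalars k

/-- The regular differentials on the preimage of `Spec k[S]`, as rational differentials: the image
in `Ω[F⁄k]` of the Kähler differentials of the ring of regular functions. -/
def regDiff (S : Set F) : Submodule k Ω[F⁄k] :=
  LinearMap.range ((KaehlerDifferential.map k k (regFun k S) F).restrictScalars k)

theorem regFun_mono {S T : Set F} (h : S ⊆ T) : regFun k S ≤ regFun k T := by
  intro a ha
  have ha' : IsIntegral (Algebra.adjoin k S) a := ha
  obtain ⟨p, hp, hpa⟩ := ha'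
  have hle : Algebra.adjoin k S ≤ Algebra.adjoin k T := Algebra.adjoin_mono h
  change IsIntegral (Algebra.adjoin k T) a
  refine ⟨p.map (Subalgebra.inclusion hle).toRingHom, hp.map _, ?_⟩
  rw [eval₂_map]
  exact hpa

theorem D_mem_regDiff {S : Set F} {a : F} (ha : a ∈ regFun k S) :
    KaehlerDifferential.D k F a ∈ regDiff k S :=
  ⟨KaehlerDifferential.D k (regFun k S) ⟨a, ha⟩, by
    simp [KaehlerDifferential.map_D]⟩

variable (x : F)

/-- `𝒪_X(U_0)`, where `U_0` is the complement of the fibre over `0`. -/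
def O0 : Subalgebra k F := regFun k {x⁻¹}

/-- `𝒪_X(U_∞)`, where `U_∞` is the complement of the fibre over `∞`. -/
def Oinf : Subalgebra k F := regFun k {x}

/-- `𝒪_X(U_0 ∩ U_∞)`. -/
def O0inf : Subalgebra k F := regFun k {x, x⁻¹}

/-- `Ω_X(U_0)`. -/
def Omega0 : Submodule k Ω[F⁄k] := regDiff k {x⁻¹}

/-- `Ω_X(U_∞)`. -/
def OmegaInf : Submodule k Ω[F⁄k] := regDiff k {x}

/-- The Čech de Rham 1-cocycles `(ω_0, ω_∞, f)` for the covering `U_0, U_∞`, with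
`df = ω_0 - ω_∞`. -/
def cocycles : Submodule k (Ω[F⁄k] × Ω[F⁄k] × F) where
  carrier := {w | w.1 ∈ Omega0 k x ∧ w.2.1 ∈ OmegaInf k x ∧ w.2.2 ∈ O0inf k x ∧
    KaehlerDifferential.D k F w.2.2 = w.1 - w.2.1}
  zero_mem' := ⟨zero_mem _, zero_mem _, zero_mem _, by simp⟩
  add_mem' := by
    rintro u v ⟨h1, h2, h3, h4⟩ ⟨h1', h2', h3', h4'⟩
    refine ⟨add_mem h1 h1', add_mem h2 h2', add_mem h3 h3', ?_⟩
    simp only [Prod.fst_add, Prod.snd_add, map_add, h4, h4']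
    abel
  smul_mem' := by
    rintro c u ⟨h1, h2, h3, h4⟩
    refine ⟨Submodule.smul_mem _ c h1, Submodule.smul_mem _ c h2,
      Subalgebra.smul_mem _ h3 c, ?_⟩
    simp only [Prod.smul_fst, Prod.smul_snd, Derivation.map_smul, h4, smul_sub]

/-- The Čech de Rham 1-coboundaries `(df_0, df_∞, f_0 - f_∞)`. -/
def coboundaries : Submodule k (Ω[F⁄k] × Ω[F⁄k] × F) where
  carrier := {w | ∃ f₀ ∈ O0 k x, ∃ f₁ ∈ Oinf k x,
    w = (KaehlerDifferential.D k F f₀, KaehlerDifferential.D k F f₁, f₀ - f₁)}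
  zero_mem' := ⟨0, zero_mem _, 0, zero_mem _, by simp only [map_zero, sub_zero]; rfl⟩
  add_mem' := by
    rintro _ _ ⟨a, ha, b, hb, rfl⟩ ⟨a', ha', b', hb', rfl⟩
    refine ⟨a + a', add_mem ha ha', b + b', add_mem hb hb', ?_⟩
    simp only [Prod.mk_add_mk, map_add, add_sub_add_comm]
  smul_mem' := by
    rintro c _ ⟨a, ha, b, hb, rfl⟩
    refine ⟨c • a, Subalgebra.smul_mem _ ha c, c • b, Subalgebra.smul_mem _ hb c, ?_⟩
    simp only [Prod.smul_mk, Derivation.map_smul, smul_sub]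

theorem coboundaries_le_cocycles : coboundaries k x ≤ cocycles k x := by
  rintro _ ⟨a, ha, b, hb, rfl⟩
  refine ⟨D_mem_regDiff k ha, D_mem_regDiff k hb, sub_mem ?_ ?_, map_sub _ _ _⟩
  · exact regFun_mono k (by simp) ha
  · exact regFun_mono k (by simp) hb

/-- `H¹_dR(X/k)`, cocycles modulo coboundaries. -/
abbrev H1dR : Type _ := cocycles k x ⧸ (coboundaries k x).submoduleOf (cocycles k x)

/-- The class of a cocycle in `H¹_dR(X/k)`. -/
def cls (w : Ω[F⁄k] × Ω[F⁄k] × F) (hw : w ∈ cocycles k x) : H1dR k x :=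
  Submodule.Quotient.mk ⟨w, hw⟩

end DeRham

/-! ### The explicit triples -/

section Triples

variable {k F : Type*} [Field k] [Field F] [Algebra k F]
  (n : ℕ) {r : ℕ} (ρ : Fin r → k) (l : Fin r → ℕ) (x y : F)

/-- The rational differential `(g_μ(x) / y ^ μ) dx`. -/
def omegaOne (μ : ℕ) : Ω[F⁄k] :=
  (aeval x (gg n ρ l μ) / y ^ μ) • KaehlerDifferential.D k F x

/-- The triple `(x^{ν-1} g_μ / y^μ dx, x^{ν-1} g_μ / y^μ dx, 0)`. -/
def deltaTriple (μ ν : ℕ) : Ω[F⁄k] × Ω[F⁄k] × F :=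
  (x ^ (ν - 1) • omegaOne n ρ l x y μ, x ^ (ν - 1) • omegaOne n ρ l x y μ, 0)

/-- The triple with entries
`(ψ^{≤ s} / (n x^{ν+1})) (g_{n-μ} / y^{n-μ}) dx`,
`- (ψ^{> s} / (n x^{ν+1})) (g_{n-μ} / y^{n-μ}) dx` and `y^μ / (x^ν g_μ)`,
where `ψ = ψ_{μ,ν}`, cut at degree `s`. -/
def aTriple (μ ν s : ℕ) : Ω[F⁄k] × Ω[F⁄k] × F :=
  ((aeval x (truncLE (psi n ρ l μ ν) s) / ((n : F) * x ^ (ν + 1))) • omegaOne n ρ l x y (n - μ),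
    -((aeval x (truncGT (psi n ρ l μ ν) s) / ((n : F) * x ^ (ν + 1))) •
      omegaOne n ρ l x y (n - μ)),
    y ^ μ / (x ^ ν * aeval x (gg n ρ l μ)))

end Triples

end KummerCover

end

noncomputable section

namespace KummerCover

/-! ### Arithmetic of the quotients and remainders of `μ λ_i` by `e_i`. -/

section Numerical

variable {n r : ℕ} (l : Fin r → ℕ)

/-! Put w_μ = y^μ / g_μ(x) (`wfun`), which depends only on μ mod n. Its n-th power is the product of
the (x - ρ_i)^{g_i υ_i}, with all exponents in [0, n), so w_μ is regular on U_∞ and generates the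
regular functions in k(x) y^μ over k[x]. The automorphism y ↦ ζ y splits F into the lines k(x) w_μ,
0 ≤ μ < n, and this reduces everything to monomials: on U_∞ the functions are spanned by x^m w_μ
with m ≥ 0 (`regFun_eq_span`), the differentials by x^m w_μ⁻¹ dx with m ≥ 0 (`regDiff_eq_span`). The
substitution x ↦ 1/x leads to a cover of the same kind, in which w_μ becomes a constant times
x^{-t^{(μ)}} w_μ and dx becomes -x^{-2} dx. Hence on U_0 the conditions are m ≤ -t^{(μ)} for
functions (`regFun_inv_eq_span`) and m ≤ t^{(μ)} - 2 for differentials (`regDiff_inv_eq_span`);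
functions on U_0 ∩ U_∞ carry no condition.

The function monomials regular on neither open set are those with m = -ν, 1 ≤ ν ≤ t^{(μ)} - 1; the
differential monomials regular on both are those with m = ν - 1 for the same ν. Since t^{(μ)} > 0
unless n divides μ (`tt_pos`), only constants are regular on both. So coboundaries and the a_{μ,ν}
can be subtracted from a cocycle until its function vanishes, and the remainder is a global
differential, a combination of the δ_{μ,ν}: this is `exists_basis_H1dR`.

It remains to see that the a_{μ,ν} are cocycles. By `D_div`, d(x^{-ν} w_μ) is ψ_{μ,ν} / (n x^{ν+1})
times w_{n-μ}⁻¹ dx. A monomial x^i of ψ contributes the exponent i - ν - 1, regular on U_∞ if i > ν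
and on U_0 if i ≤ ν + t^{(n-μ)} - 1, so the admitted values of s are valid places to cut. -/

theorem numPts_pos (hn : n ≠ 0) (i : Fin r) : 0 < numPts n l i :=
  Nat.gcd_pos_of_pos_left _ (Nat.pos_of_ne_zero hn)

theorem numPts_mul_ramIdx (i : Fin r) : numPts n l i * ramIdx n l i = n :=
  Nat.mul_div_cancel' (Nat.gcd_dvd_left _ _)

theorem numPts_mul_lam (i : Fin r) : numPts n l i * lam n l i = l i :=
  Nat.mul_div_cancel' (Nat.gcd_dvd_right _ _)

theorem ramIdx_pos (hn : n ≠ 0) (i : Fin r) : 0 < ramIdx n l i :=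
  Nat.pos_of_ne_zero fun h => hn (by rw [← numPts_mul_ramIdx (n := n) l i, h, mul_zero])

theorem n_mul_lam (i : Fin r) : n * lam n l i = l i * ramIdx n l i := by
  have h1 := numPts_mul_ramIdx (n := n) l i
  have h2 := numPts_mul_lam (n := n) l i
  calc n * lam n l i = numPts n l i * ramIdx n l i * lam n l i := by rw [h1]
    _ = numPts n l i * lam n l i * ramIdx n l i := by ring
    _ = l i * ramIdx n l i := by rw [h2]

theorem coprime_lam (hn : n ≠ 0) (i : Fin r) : (lam n l i).Coprime (ramIdx n l i) :=
  (Nat.coprime_div_gcd_div_gcd (numPts_pos l hn i)).symm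

theorem rem_add_quo (μ : ℕ) (i : Fin r) :
    rem n l μ i + ramIdx n l i * quo n l μ i = μ * lam n l i := Nat.mod_add_div _ _

theorem rem_lt (hn : n ≠ 0) (μ : ℕ) (i : Fin r) : rem n l μ i < ramIdx n l i :=
  Nat.mod_lt _ (ramIdx_pos l hn i)

theorem numPts_mul_rem_lt (hn : n ≠ 0) (μ : ℕ) (i : Fin r) : numPts n l i * rem n l μ i < n := by
  calc _ < numPts n l i * ramIdx n l i :=
        Nat.mul_lt_mul_of_pos_left (rem_lt l hn μ i) (numPts_pos l hn i)
    _ = n := numPts_mul_ramIdx l i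

theorem numPts_mul_rem_add (μ : ℕ) (i : Fin r) :
    numPts n l i * rem n l μ i + n * quo n l μ i = μ * l i := by
  calc _ = numPts n l i * rem n l μ i + numPts n l i * ramIdx n l i * quo n l μ i := by
        rw [numPts_mul_ramIdx]
    _ = numPts n l i * (rem n l μ i + ramIdx n l i * quo n l μ i) := by ring
    _ = μ * (numPts n l i * lam n l i) := by rw [rem_add_quo]; ring
    _ = μ * l i := by rw [numPts_mul_lam]

theorem quo_add_mul (hn : n ≠ 0) (μ c : ℕ) (i : Fin r) :
    quo n l (μ + n * c) i = quo n l μ i + c * l i := by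
  unfold quo
  rw [show (μ + n * c) * lam n l i = μ * lam n l i + c * l i * ramIdx n l i by
    rw [mul_assoc, ← n_mul_lam]; ring]
  exact Nat.add_mul_div_right _ _ (ramIdx_pos l hn i)

theorem rem_add_mul (μ c : ℕ) (i : Fin r) : rem n l (μ + n * c) i = rem n l μ i := by
  unfold rem
  rw [show (μ + n * c) * lam n l i = μ * lam n l i + c * l i * ramIdx n l i by
    rw [mul_assoc, ← n_mul_lam]; ring]
  exact Nat.add_mul_mod_self_right _ _ _

theorem quo_zero (i : Fin r) : quo n l 0 i = 0 := by simp [quo]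

theorem rem_zero (i : Fin r) : rem n l 0 i = 0 := by simp [rem]

theorem tt_zero : tt n l 0 = 0 := by simp [tt, rem_zero]

theorem tt_add_mul (μ c : ℕ) : tt n l (μ + n * c) = tt n l μ := by
  simp only [tt, rem_add_mul]

theorem tt_mod (μ : ℕ) : tt n l (μ % n) = tt n l μ := by
  conv_rhs => rw [← Nat.mod_add_div μ n]
  rw [tt_add_mul]

/-- The exponent of `x - ρ_i` in the product `w_μ w_ν / w_{μ+ν}`. -/
def carry (n : ℕ) (μ ν : ℕ) (i : Fin r) : ℕ := quo n l (μ + ν) i - quo n l μ i - quo n l ν i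

/-- Floors are superadditive, so the truncated subtractions defining `carry` lose nothing. -/
theorem quo_add (μ ν : ℕ) (i : Fin r) :
    quo n l (μ + ν) i = quo n l μ i + quo n l ν i + carry l n μ ν i := by
  have : quo n l μ i + quo n l ν i ≤ quo n l (μ + ν) i := by
    unfold quo
    rw [add_mul]
    exact Nat.div_add_div_le_add_div
  unfold carry
  omega

theorem rem_add_rem (μ ν : ℕ) (i : Fin r) :
    rem n l μ i + rem n l ν i = rem n l (μ + ν) i + ramIdx n l i * carry l n μ ν i := by
  have h1 := rem_add_quo (n := n) l μ i
  have h2 := rem_add_quo (n := n) l ν i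
  have h3 := rem_add_quo (n := n) l (μ + ν) i
  rw [quo_add, add_mul] at h3
  simp only [mul_add] at h3
  omega

theorem carry_eq_zero (μ ν : ℕ) (i : Fin r)
    (h : rem n l μ i + rem n l ν i < ramIdx n l i) : carry l n μ ν i = 0 := by
  have := rem_add_rem (n := n) l μ ν i
  by_contra h0
  have : ramIdx n l i * 1 ≤ ramIdx n l i * carry l n μ ν i :=
    Nat.mul_le_mul_left _ (Nat.one_le_iff_ne_zero.2 h0)
  omega

/-- The two remainders sum to a multiple of `e_i` below `2 e_i`, so to `0` or `e_i`. -/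
theorem carry_of_dvd (hn : n ≠ 0) (μ ν : ℕ) (h : n ∣ μ + ν) (i : Fin r) :
    carry l n μ ν i = if rem n l μ i ≠ 0 then 1 else 0 := by
  obtain ⟨c, hc⟩ := h
  have h0 : rem n l (μ + ν) i = 0 := by
    rw [hc, ← zero_add (n * c), rem_add_mul, rem_zero]
  have h1 := rem_add_rem (n := n) l μ ν i
  have h2 := rem_lt l hn μ i
  have h3 := rem_lt l hn ν i
  rw [h0, zero_add] at h1
  have h4 : carry l n μ ν i < 2 := by
    by_contra h5
    have : ramIdx n l i * 2 ≤ ramIdx n l i * carry l n μ ν i :=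
      Nat.mul_le_mul_left _ (not_lt.1 h5)
    omega
  obtain h5 | h5 : carry l n μ ν i = 0 ∨ carry l n μ ν i = 1 := by omega
  · rw [h5] at h1 ⊢
    rw [if_neg]
    simp at h1 ⊢
    exact h1.1
  · rw [h5] at h1 ⊢
    rw [if_pos]
    omega

/-- `λ_i` is invertible modulo `e_i`. Since w_μ has order `υ_i` at the points above `ρ_i`, this
provides a w_μ that is a uniformizer there. -/
theorem exists_rem_eq_one (hn : n ≠ 0) (i : Fin r) (h : 2 ≤ ramIdx n l i) :
    ∃ μ, rem n l μ i = 1 := by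
  obtain ⟨m, hm⟩ := Nat.exists_mul_mod_eq_one_of_coprime (coprime_lam l hn i) h
  exact ⟨m, by rw [rem, mul_comm, hm.2]⟩

/-- With `deg f = n L`, this says `t = μ L - deg g_μ`, the power of x that appears when w_μ is
rewritten in the coordinate 1/x. -/
theorem tt_eq_sub (hn : n ≠ 0) {L : ℕ} (hL : ∑ i, l i = n * L) (μ : ℕ) :
    (tt n l μ : ℤ) = μ * L - ∑ i, (quo n l μ i : ℤ) := by
  have h1 := mul_tt n l ⟨L, hL⟩ μ
  have h2 : n * tt n l μ + n * ∑ i, quo n l μ i = n * (μ * L) := by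
    rw [h1, Finset.mul_sum, ← Finset.sum_add_distrib]
    simp_rw [numPts_mul_rem_add]
    rw [← Finset.mul_sum, hL]
    ring
  rw [← mul_add] at h2
  have h3 := Nat.eq_of_mul_eq_mul_left (Nat.pos_of_ne_zero hn) h2
  zify at h3
  linarith

end Numerical

/-! ### Products of the `x - ρ_i` and their logarithmic derivatives. -/

section Polynomials

variable {k : Type*} [Field k] {n r : ℕ} (ρ : Fin r → k) (l : Fin r → ℕ)

/-- `∏ (x - ρ_i) ^ {a_i}`. -/
def prodPow (a : Fin r → ℕ) : k[X] := ∏ i, (X - C (ρ i)) ^ a i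

theorem prodPow_ne_zero (a : Fin r → ℕ) : prodPow ρ a ≠ 0 :=
  Finset.prod_ne_zero_iff.2 fun _ _ => pow_ne_zero _ (X_sub_C_ne_zero _)

theorem prodPow_add (a b : Fin r → ℕ) :
    prodPow ρ (fun i => a i + b i) = prodPow ρ a * prodPow ρ b := by
  simp [prodPow, pow_add, Finset.prod_mul_distrib]

theorem prodPow_mul (a : Fin r → ℕ) (c : ℕ) :
    prodPow ρ (fun i => a i * c) = prodPow ρ a ^ c := by
  simp [prodPow, pow_mul, Finset.prod_pow]

theorem eval_prodPow (a : Fin r → ℕ) (c : k) :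
    (prodPow ρ a).eval c = ∏ i, (c - ρ i) ^ a i := by
  simp [prodPow, eval_prod]

theorem gg_eq (μ : ℕ) : gg n ρ l μ = prodPow ρ (quo n l μ) := rfl

theorem ff_eq : ff ρ l = prodPow ρ l := rfl

theorem gg_zero : gg n ρ l 0 = 1 := by simp [gg, quo_zero]

/-- `∏_{i ∈ I^{(μ)}} (x - ρ_i)`. -/
def ramPoly (n : ℕ) (μ : ℕ) : k[X] := ∏ i ∈ ramSet n l μ, (X - C (ρ i))

/-- `∑ g_i υ_i^{(μ)} ∏_{j ∈ I^{(μ)} \ {i}} (x - ρ_j)`. -/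
def dlogPoly (n : ℕ) (μ : ℕ) : k[X] :=
  ∑ i, C ((numPts n l i * rem n l μ i : ℕ) : k) * ∏ j ∈ (ramSet n l μ).erase i, (X - C (ρ j))

theorem psi_eq (μ ν : ℕ) :
    psi n ρ l μ ν = X * dlogPoly ρ l n μ - C ((ν * n : ℕ) : k) * ramPoly ρ l n μ := by
  rw [psi, dlogPoly, ramPoly, Finset.mul_sum]
  congr 1
  exact Finset.sum_congr rfl fun i _ => by ring

theorem prodPow_carry (hn : n ≠ 0) {μ ν : ℕ} (h : n ∣ μ + ν) :
    prodPow ρ (carry l n μ ν) = ramPoly ρ l n μ := by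
  unfold prodPow ramPoly ramSet
  rw [Finset.prod_filter]
  refine Finset.prod_congr rfl fun i _ => ?_
  rw [carry_of_dvd l hn μ ν h i]
  split_ifs <;> simp

/-- The logarithmic derivative is ∑ g_i υ_i / (x - ρ_i); indices with `υ_i = 0` drop out, so
`ramPoly` is a common denominator. -/
theorem derivative_mul_ramPoly (μ : ℕ) :
    derivative (prodPow ρ fun i => numPts n l i * rem n l μ i) * ramPoly ρ l n μ =
      (prodPow ρ fun i => numPts n l i * rem n l μ i) * dlogPoly ρ l n μ := by
  unfold prodPow dlogPoly
  rw [derivative_prod_finset, Finset.sum_mul, Finset.mul_sum]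
  refine Finset.sum_congr rfl fun i _ => ?_
  rw [derivative_X_sub_C_pow]
  by_cases h : rem n l μ i = 0
  · simp [h]
  by_cases h' : numPts n l i = 0
  · simp [h']
  have hi : i ∈ ramSet n l μ := by simp [ramSet, h]
  rw [ramPoly, ← Finset.mul_prod_erase _ _ hi, ← Finset.prod_erase_mul Finset.univ _ (Finset.mem_univ i)]
  obtain ⟨a, ha⟩ := Nat.exists_eq_succ_of_ne_zero (Nat.mul_ne_zero h' h)
  simp only [ha]
  rw [Nat.succ_eq_add_one, Nat.add_sub_cancel, pow_succ]
  ring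

/-- At `ρ_i` only the i-th summand survives; its coefficient is `g_i`, a divisor of n and therefore
nonzero in k. -/
theorem eval_dlogPoly_ne_zero (hρ : Function.Injective ρ) (hnk : (n : k) ≠ 0) {μ : ℕ} {i : Fin r}
    (h : rem n l μ i = 1) : (dlogPoly ρ l n μ).eval (ρ i) ≠ 0 := by
  have hi : i ∈ ramSet n l μ := by simp [ramSet, h]
  rw [dlogPoly, eval_finsetSum, Finset.sum_eq_single i]
  · rw [eval_mul, eval_C, eval_prod, h, mul_one]
    refine mul_ne_zero (fun h0 => hnk ?_) (Finset.prod_ne_zero_iff.2 fun j hj => ?_)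
    · rw [← numPts_mul_ramIdx (n := n) l i, Nat.cast_mul, h0, zero_mul]
    · simpa [sub_eq_zero] using fun h => (Finset.ne_of_mem_erase hj) (hρ h).symm
  · intro j _ hj
    rw [eval_mul, eval_prod, Finset.prod_eq_zero (i := i)]
    · simp
    · exact Finset.mem_erase.2 ⟨hj.symm, hi⟩
    · simp
  · simp

/-- A root of q would be a root of the product of multiplicity at least n, but each multiplicity is
some `a i < n`. -/
theorem isUnit_of_pow_dvd_prodPow [IsAlgClosed k] (hn : n ≠ 0) (hρ : Function.Injective ρ)
    {a : Fin r → ℕ} (ha : ∀ i, a i < n) {q : k[X]} (hq : q ^ n ∣ prodPow ρ a) : IsUnit q := by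
  by_contra hu
  have hq0 : q ≠ 0 := by
    rintro rfl
    rw [zero_pow hn] at hq
    exact prodPow_ne_zero ρ a (zero_dvd_iff.1 hq)
  obtain ⟨c, hc⟩ := IsAlgClosed.exists_root q fun h => hu (isUnit_iff_degree_eq_zero.2 h)
  have hd : (X - C c) ^ n ∣ prodPow ρ a := (pow_dvd_pow_of_dvd (dvd_iff_isRoot.2 hc) n).trans hq
  have h0 : (prodPow ρ a).eval c = 0 :=
    dvd_iff_isRoot.1 ((dvd_pow_self _ hn).trans hd)
  rw [eval_prodPow, Finset.prod_eq_zero_iff] at h0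
  obtain ⟨i, -, hi⟩ := h0
  obtain rfl : c = ρ i := sub_eq_zero.1 (eq_zero_of_pow_eq_zero hi)
  have h1 := (pow_dvd_pow (X - C (ρ i)) (Nat.succ_le_of_lt (ha i))).trans hd
  rw [prodPow, ← Finset.mul_prod_erase _ _ (Finset.mem_univ i), pow_succ] at h1
  have h2 := dvd_iff_isRoot.1
    ((mul_dvd_mul_iff_left (pow_ne_zero (a i) (X_sub_C_ne_zero (ρ i)))).1 h1)
  rw [IsRoot.def, eval_prod, Finset.prod_eq_zero_iff] at h2
  obtain ⟨j, hj, hj'⟩ := h2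
  rw [eval_pow, eval_sub, eval_X, eval_C] at hj'
  exact Finset.ne_of_mem_erase hj (hρ (sub_eq_zero.1 (eq_zero_of_pow_eq_zero hj'))).symm

end Polynomials

/-! ### The functions w_μ and the coordinate ring of U_∞. -/

section Affine

variable {k F : Type*} [Field k] [Field F] [Algebra k F] {n r : ℕ} {ρ : Fin r → k} {l : Fin r → ℕ}
  {x y : F}

/-- The field `F` is the compositum of `k(x)` and `k(y)`, where `y ^ n = f(x)` defines a Kummer
extension of degree `n` of `k(x)`. -/
structure IsKummer (n : ℕ) {r : ℕ} (ρ : Fin r → k) (l : Fin r → ℕ) (x y : F) : Prop where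
  transcendental : Transcendental k x
  cast_ne_zero : (n : k) ≠ 0
  injective : Function.Injective ρ
  pow_eq : y ^ n = aeval x (ff ρ l)
  exists_sum : ∀ b : F, ∃ c : ℕ → F, (∀ j, c j ∈ IntermediateField.adjoin k {x}) ∧
    b = ∑ j ∈ Finset.range n, c j * y ^ j
  exists_algHom : ∃ ζ : k, IsPrimitiveRoot ζ n ∧ ∃ σ : F →ₐ[k] F, σ x = x ∧ σ y = ζ • y

/-- The function `w_μ = y ^ μ / g_μ(x)`. -/
def wfun (n : ℕ) {r : ℕ} (ρ : Fin r → k) (l : Fin r → ℕ) (x y : F) (μ : ℕ) : F :=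
  y ^ μ / aeval x (gg n ρ l μ)

theorem omegaOne_eq (μ : ℕ) :
    omegaOne n ρ l x y μ = (wfun n ρ l x y μ)⁻¹ • KaehlerDifferential.D k F x := by
  rw [omegaOne, wfun, inv_div]

theorem wfun_zero : wfun n ρ l x y 0 = 1 := by simp [wfun, gg_zero]

namespace IsKummer

variable (H : IsKummer n ρ l x y)
include H

theorem ne_zero : n ≠ 0 := fun h => H.cast_ne_zero (by simp [h])

theorem aeval_ne_zero {p : k[X]} (hp : p ≠ 0) : aeval x p ≠ 0 := fun h =>
  hp (transcendental_iff.1 H.transcendental p h)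

theorem x_ne_zero : x ≠ 0 := by simpa using H.aeval_ne_zero X_ne_zero

theorem y_ne_zero : y ≠ 0 := fun h => by
  have := H.pow_eq
  rw [h, zero_pow H.ne_zero] at this
  exact H.aeval_ne_zero (prodPow_ne_zero ρ l) this.symm

theorem wfun_ne_zero (μ : ℕ) : wfun n ρ l x y μ ≠ 0 :=
  div_ne_zero (pow_ne_zero _ H.y_ne_zero) (H.aeval_ne_zero (prodPow_ne_zero ρ _))

theorem wfun_mul_wfun (μ ν : ℕ) : wfun n ρ l x y μ * wfun n ρ l x y ν =
    aeval x (prodPow ρ (carry l n μ ν)) * wfun n ρ l x y (μ + ν) := by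
  have h : gg n ρ l (μ + ν) = gg n ρ l μ * gg n ρ l ν * prodPow ρ (carry l n μ ν) := by
    simp only [gg_eq, ← prodPow_add]
    congr 1
    exact funext (quo_add l μ ν)
  have h1 := H.aeval_ne_zero (prodPow_ne_zero ρ (quo n l μ))
  have h2 := H.aeval_ne_zero (prodPow_ne_zero ρ (quo n l ν))
  have h3 := H.aeval_ne_zero (prodPow_ne_zero ρ (carry l n μ ν))
  rw [← gg_eq] at h1 h2
  unfold wfun
  rw [h, map_mul, map_mul]
  field_simp
  ring

theorem wfun_add_mul (μ c : ℕ) : wfun n ρ l x y (μ + n * c) = wfun n ρ l x y μ := by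
  have h : gg n ρ l (μ + n * c) = gg n ρ l μ * ff ρ l ^ c := by
    rw [gg_eq, gg_eq, ff_eq, ← prodPow_mul, ← prodPow_add]
    congr 1
    funext i
    rw [quo_add_mul l H.ne_zero, mul_comm c]
  have h1 := H.aeval_ne_zero (prodPow_ne_zero ρ (quo n l μ))
  have h2 := H.aeval_ne_zero (prodPow_ne_zero ρ l)
  rw [← gg_eq] at h1
  rw [← ff_eq] at h2
  unfold wfun
  rw [h, map_mul, map_pow, pow_add, pow_mul, H.pow_eq]
  field_simp

theorem wfun_mod (μ : ℕ) : wfun n ρ l x y (μ % n) = wfun n ρ l x y μ := by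
  conv_rhs => rw [← Nat.mod_add_div μ n]
  rw [H.wfun_add_mul]

theorem wfun_eq_of_modEq {μ ν : ℕ} (h : μ ≡ ν [MOD n]) :
    wfun n ρ l x y μ = wfun n ρ l x y ν := by
  rw [← H.wfun_mod μ, ← H.wfun_mod ν, h]

theorem wfun_mul_wfun_of_dvd {μ ν : ℕ} (h : n ∣ μ + ν) :
    wfun n ρ l x y μ * wfun n ρ l x y ν = aeval x (ramPoly ρ l n μ) := by
  rw [H.wfun_mul_wfun, prodPow_carry ρ l H.ne_zero h,
    H.wfun_eq_of_modEq (Nat.modEq_zero_iff_dvd.2 h), wfun_zero, mul_one]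

/-- Follows from `g_i υ_i + n m_i = μ l_i`. It shows that w_μ is integral over k[x], and its
exponents below n leave no room for a denominator. -/
theorem wfun_pow (μ : ℕ) :
    wfun n ρ l x y μ ^ n = aeval x (prodPow ρ fun i => numPts n l i * rem n l μ i) := by
  have h : (prodPow ρ fun i => numPts n l i * rem n l μ i) * gg n ρ l μ ^ n = ff ρ l ^ μ := by
    rw [gg_eq, ff_eq, ← prodPow_mul, ← prodPow_mul, ← prodPow_add]
    congr 1
    funext i
    rw [mul_comm (quo _ _ _ _), numPts_mul_rem_add, mul_comm]
  have h1 := H.aeval_ne_zero (prodPow_ne_zero ρ (quo n l μ))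
  rw [← gg_eq] at h1
  rw [wfun, div_pow, ← pow_mul, mul_comm, pow_mul, H.pow_eq, ← map_pow (aeval x) (ff ρ l), ← h,
    map_mul, map_pow]
  field_simp

/-- Differentiate w_μ^n = P: then n w_μ^{n-1} dw_μ = P' dx, where P' · `ramPoly` = P · `dlogPoly`,
and `ramPoly` is w_μ w_ν by `wfun_mul_wfun_of_dvd`. -/
theorem smul_D_wfun {μ ν : ℕ} (h : n ∣ μ + ν) :
    (n : F) • KaehlerDifferential.D k F (wfun n ρ l x y μ) =
      aeval x (dlogPoly ρ l n μ) • omegaOne n ρ l x y ν := by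
  have h1 := congrArg (KaehlerDifferential.D k F) (H.wfun_pow μ)
  rw [Derivation.leibniz_pow, Derivation.map_aeval] at h1
  have h2 := congrArg (aeval x) (derivative_mul_ramPoly ρ l (n := n) μ)
  rw [map_mul, map_mul, ← H.wfun_pow μ, ← H.wfun_mul_wfun_of_dvd h] at h2
  have hμ := H.wfun_ne_zero μ
  have hν := H.wfun_ne_zero ν
  rw [← Nat.cast_smul_eq_nsmul F, smul_smul] at h1
  have hn : wfun n ρ l x y μ ^ n = wfun n ρ l x y μ ^ (n - 1) * wfun n ρ l x y μ := by
    rw [← pow_succ, Nat.sub_add_cancel (Nat.pos_of_ne_zero H.ne_zero)]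
  have h3 : wfun n ρ l x y μ ^ (n - 1) ≠ 0 := pow_ne_zero _ hμ
  have h4 : (wfun n ρ l x y μ ^ (n - 1))⁻¹ *
      aeval x (derivative (prodPow ρ fun i => numPts n l i * rem n l μ i)) =
        aeval x (dlogPoly ρ l n μ) * (wfun n ρ l x y ν)⁻¹ := by
    rw [hn] at h2
    field_simp
    apply mul_right_cancel₀ hμ
    linear_combination h2
  rw [omegaOne_eq, smul_smul, ← h4, mul_smul, ← h1, smul_smul]
  congr 1
  field_simp

/-- The polynomial ring is integrally closed; the statement is transported along k[X] ≅ k[x]. -/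
theorem dvd_of_isIntegral {p q : k[X]} (hq : q ≠ 0)
    (h : IsIntegral (Algebra.adjoin k {x}) (aeval x p / aeval x q)) : q ∣ p := by
  let _ : Algebra k[X] F := (aeval x : k[X] →ₐ[k] F).toRingHom.toAlgebra
  have hmap : ∀ a : k[X], algebraMap k[X] F a = aeval x a := fun _ => rfl
  have hinj : Function.Injective (algebraMap k[X] F) :=
    (injective_iff_map_eq_zero _).2 fun a ha => transcendental_iff.1 H.transcendental a ha
  have h1 : IsIntegral k[X] (aeval x p / aeval x q) := by
    refine h.map_of_comp_eq ((algEquivOfTranscendental k x H.transcendental).symm :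
      Algebra.adjoin k {x} →+* k[X]) (RingHom.id F) (RingHom.ext fun a => ?_)
    obtain ⟨a, rfl⟩ := (algEquivOfTranscendental k x H.transcendental).surjective a
    simp [hmap]
  have : FaithfulSMul k[X] F := (faithfulSMul_iff_algebraMap_injective _ _).2 hinj
  let _ : Algebra (FractionRing k[X]) F := FractionRing.liftAlgebra k[X] F
  have hz : algebraMap (FractionRing k[X]) F
      (algebraMap k[X] (FractionRing k[X]) p / algebraMap k[X] (FractionRing k[X]) q) =
        aeval x p / aeval x q := by
    rw [map_div₀, ← IsScalarTower.algebraMap_apply, ← IsScalarTower.algebraMap_apply, hmap, hmap]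
  rw [← hz, isIntegral_algebraMap_iff (FaithfulSMul.algebraMap_injective _ _),
    IsIntegrallyClosed.isIntegral_iff] at h1
  obtain ⟨t, ht⟩ := h1
  have hq' : algebraMap k[X] (FractionRing k[X]) q ≠ 0 := by simpa using hq
  rw [eq_div_iff hq', ← map_mul] at ht
  exact ⟨t, by rw [mul_comm]; exact (IsFractionRing.injective k[X] (FractionRing k[X]) ht).symm⟩

/-- Write h = p'/q' in lowest terms. The n-th power of h w_μ is integral and lies in k(x), so q'^n
divides the product w_μ^n, whose exponents are below n; hence q' is a unit. -/
theorem exists_aeval_of_isIntegral [IsAlgClosed k] {h : F} (hh : h ∈ IntermediateField.adjoin k {x})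
    {μ : ℕ} (hi : IsIntegral (Algebra.adjoin k {x}) (h * wfun n ρ l x y μ)) :
    ∃ p : k[X], h = aeval x p := by
  obtain ⟨p, q, rfl⟩ := (IntermediateField.mem_adjoin_simple_iff k h).1 hh
  by_cases hq : q = 0
  · exact ⟨0, by simp [hq]⟩
  classical
  set d := gcd p q
  have hd : d ≠ 0 := fun h0 => hq ((gcd_eq_zero_iff _ _).1 h0).2
  obtain ⟨p', hp'⟩ : d ∣ p := gcd_dvd_left p q
  obtain ⟨q', hq'⟩ : d ∣ q := gcd_dvd_right p q
  have hcop : IsCoprime p' q' := by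
    have := isCoprime_div_gcd_div_gcd (p := p) (q := q) hq
    rwa [← EuclideanDomain.eq_div_of_mul_eq_right hd hp'.symm,
      ← EuclideanDomain.eq_div_of_mul_eq_right hd hq'.symm] at this
  have hq0 : q' ≠ 0 := by rintro rfl; simp [hq'] at hq
  have hpq : aeval x p / aeval x q = aeval x p' / aeval x q' := by
    rw [hp', hq', map_mul, map_mul, mul_div_mul_left _ _ (H.aeval_ne_zero hd)]
  rw [hpq] at hi ⊢
  have h2 := hi.pow n
  rw [mul_pow, H.wfun_pow, div_pow, div_mul_eq_mul_div, ← map_pow, ← map_pow, ← map_mul] at h2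
  have h3 := (hcop.symm.pow (m := n) (n := n)).dvd_of_dvd_mul_left
    (H.dvd_of_isIntegral (pow_ne_zero n hq0) h2)
  have h4 := isUnit_of_pow_dvd_prodPow ρ H.ne_zero H.injective
    (numPts_mul_rem_lt l H.ne_zero μ) h3
  obtain ⟨s, hs⟩ := h4.exists_right_inv
  refine ⟨p' * s, ?_⟩
  rw [div_eq_iff (H.aeval_ne_zero hq0), ← map_mul, mul_assoc, mul_comm s, hs, mul_one]

end IsKummer

/-- The function `x ^ m w_j`, where `q = (m, j)`. -/
def efun (n : ℕ) {r : ℕ} (ρ : Fin r → k) (l : Fin r → ℕ) (x y : F) (q : ℤ × ℕ) : F :=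
  x ^ q.1 * wfun n ρ l x y q.2

/-- The differential `x ^ m w_j⁻¹ dx`, where `q = (m, j)`. -/
def edif (n : ℕ) {r : ℕ} (ρ : Fin r → k) (l : Fin r → ℕ) (x y : F) (q : ℤ × ℕ) : Ω[F⁄k] :=
  x ^ q.1 • omegaOne n ρ l x y q.2

namespace IsKummer

variable (H : IsKummer n ρ l x y)

theorem aeval_mul_wfun_mem (p : k[X]) (j : ℕ) : aeval x p * wfun n ρ l x y j ∈
    Submodule.span k (efun n ρ l x y '' {q | 0 ≤ q.1}) := by
  rw [aeval_eq_sum_range, Finset.sum_mul]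
  refine Submodule.sum_mem _ fun i _ => ?_
  rw [smul_mul_assoc]
  exact Submodule.smul_mem _ _ (Submodule.subset_span ⟨(i, j), by simp, by simp [efun]⟩)

theorem aeval_smul_omegaOne_mem (p : k[X]) (j : ℕ) : aeval x p • omegaOne n ρ l x y j ∈
    Submodule.span k (edif n ρ l x y '' {q | 0 ≤ q.1}) := by
  rw [aeval_eq_sum_range, Finset.sum_smul]
  refine Submodule.sum_mem _ fun i _ => ?_
  rw [smul_assoc]
  exact Submodule.smul_mem _ _ (Submodule.subset_span ⟨(i, j), by simp, by simp [edif]⟩)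

theorem self_mem_regFun {S : Set F} {a : F} (ha : a ∈ S) : a ∈ regFun k S :=
  isIntegral_algebraMap (R := Algebra.adjoin k S) (A := F)
    (x := ⟨a, Algebra.subset_adjoin ha⟩)

theorem aeval_mem_regFun (p : k[X]) : aeval x p ∈ regFun k {x} := by
  have h : x ∈ regFun k {x} := self_mem_regFun rfl
  rw [aeval_eq_sum_range]
  exact (regFun k {x}).sum_mem fun i _ =>
    (regFun k {x}).smul_mem ((regFun k {x}).pow_mem h i) _

include H

theorem wfun_mem_regFun (j : ℕ) : wfun n ρ l x y j ∈ regFun k {x} := by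
  refine IsIntegral.of_pow (Nat.pos_of_ne_zero H.ne_zero) ?_
  rw [H.wfun_pow]
  exact aeval_mem_regFun _

/-- The conjugates of an integral element under y ↦ ζ y are integral. As n is invertible, so is each
eigencomponent c_j y^j, and `exists_aeval_of_isIntegral` then treats one component at a time. -/
theorem regFun_eq_span [IsAlgClosed k] : Subalgebra.toSubmodule (regFun k {x}) =
    Submodule.span k (efun n ρ l x y '' {q | 0 ≤ q.1}) := by
  apply le_antisymm
  · intro b hb
    replace hb : IsIntegral (Algebra.adjoin k {x}) b := hb
    obtain ⟨c, hc, hbc⟩ := H.exists_sum b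
    obtain ⟨ζ, hζ, σ, hσx, hσy⟩ := H.exists_algHom
    have hn : (n : k) ≠ 0 := H.cast_ne_zero
    have hζ0 : ζ ≠ 0 := hζ.ne_zero H.ne_zero
    have hσ : ∀ a ∈ IntermediateField.adjoin k {x}, σ a = a := by
      intro a ha
      obtain ⟨p, q, rfl⟩ := (IntermediateField.mem_adjoin_simple_iff k a).1 ha
      rw [map_div₀, ← aeval_algHom_apply, ← aeval_algHom_apply, hσx]
    have hσi : ∀ a ∈ IntermediateField.adjoin k {x}, ∀ i : ℕ, (σ ^ i) a = a := by
      intro a ha i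
      induction i with
      | zero => rfl
      | succ i ih => rw [pow_succ, AlgHom.mul_apply, hσ a ha, ih]
    have hσy' : ∀ i : ℕ, (σ ^ i) y = ζ ^ i • y := by
      intro i
      induction i with
      | zero => simp
      | succ i ih => rw [pow_succ, AlgHom.mul_apply, hσy, map_smul, ih, smul_smul, pow_succ']
    have hint : ∀ (i : ℕ), IsIntegral (Algebra.adjoin k {x}) ((σ ^ i) b) := by
      intro i
      refine hb.map_of_comp_eq (RingHom.id _) ((σ ^ i : F →ₐ[k] F) : F →+* F)
        (RingHom.ext fun a => ?_)
      exact (hσi a (IntermediateField.algebra_adjoin_le_adjoin k {x} a.2) i).symm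
    have hpow : ∀ i j : ℕ, (σ ^ i) (c j * y ^ j) = (ζ ^ j) ^ i • (c j * y ^ j) := by
      intro i j
      rw [map_mul, map_pow, hσi _ (hc j), hσy', _root_.smul_pow, mul_smul_comm, ← pow_mul, ← pow_mul,
        mul_comm i j]
    -- Discrete Fourier inversion: the other components are multiplied by a geometric sum over a
    -- nontrivial n-th root of unity, which vanishes.
    have hproj : ∀ j < n, (n : k) • (c j * y ^ j) =
        ∑ i ∈ Finset.range n, ((ζ ^ j)⁻¹ ^ i) • (σ ^ i) b := by
      intro j hj
      conv_rhs => rw [hbc]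
      simp_rw [map_sum, hpow, Finset.smul_sum, smul_smul]
      rw [Finset.sum_comm]
      simp_rw [← Finset.sum_smul, ← mul_pow]
      rw [Finset.sum_eq_single_of_mem j (Finset.mem_range.2 hj)]
      · simp [hζ0]
      · intro m hm hmj
        rw [geom_sum_eq, mul_pow, inv_pow, ← pow_mul, ← pow_mul, mul_comm j, mul_comm m, pow_mul,
          pow_mul, hζ.pow_eq_one]
        · simp
        · rw [Ne, inv_mul_eq_one₀ (pow_ne_zero _ hζ0)]
          exact fun h => hmj (hζ.pow_inj hj (Finset.mem_range.1 hm) h).symm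
    rw [hbc]
    refine Submodule.sum_mem _ fun j hj => ?_
    have h1 : IsIntegral (Algebra.adjoin k {x}) (c j * y ^ j) := by
      have h2 : (n : k)⁻¹ • (n : k) • (c j * y ^ j) ∈ regFun k {x} := by
        rw [hproj j (Finset.mem_range.1 hj)]
        exact Subalgebra.smul_mem _ (Subalgebra.sum_mem _ fun i _ =>
          Subalgebra.smul_mem _ (hint i) _) _
      rwa [inv_smul_smul₀ hn] at h2
    have hg := H.aeval_ne_zero (prodPow_ne_zero ρ (quo n l j))
    rw [← gg_eq] at hg
    have h2 : c j * y ^ j = (c j * aeval x (gg n ρ l j)) * wfun n ρ l x y j := by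
      rw [wfun, mul_assoc, mul_div_cancel₀ _ hg]
    rw [h2] at h1 ⊢
    have h3 : aeval x (gg n ρ l j) ∈ IntermediateField.adjoin k {x} :=
      (IntermediateField.mem_adjoin_simple_iff k _).2 ⟨gg n ρ l j, 1, by simp⟩
    obtain ⟨p, hp⟩ := H.exists_aeval_of_isIntegral (mul_mem (hc j) h3) h1
    rw [hp]
    exact aeval_mul_wfun_mem p j
  · rw [Submodule.span_le]
    rintro _ ⟨⟨m, j⟩, hm, rfl⟩
    obtain ⟨m, rfl⟩ := Int.eq_ofNat_of_zero_le hm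
    have h1 := (regFun k {x}).mul_mem ((regFun k {x}).pow_mem (self_mem_regFun rfl) m)
      (H.wfun_mem_regFun j)
    simpa [efun] using h1

end IsKummer

end Affine

/-! ### Regular differentials on U_∞. -/

section RegDiff

variable {k F : Type*} [Field k] [Field F] [Algebra k F]

theorem smul_mem_regDiff {S : Set F} {a : F} (ha : a ∈ regFun k S) {ω : Ω[F⁄k]}
    (hω : ω ∈ regDiff k S) : a • ω ∈ regDiff k S := by
  obtain ⟨τ, rfl⟩ := hω
  exact ⟨(⟨a, ha⟩ : regFun k S) • τ, map_smul (KaehlerDifferential.map k k (regFun k S) F) _ τ⟩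

/-- The Kähler differentials of the ring of regular functions are generated over that ring by exact
ones. -/
theorem regDiff_le {S : Set F} {M : Submodule k Ω[F⁄k]}
    (hD : ∀ a ∈ regFun k S, KaehlerDifferential.D k F a ∈ M)
    (hM : ∀ a ∈ regFun k S, ∀ ω ∈ M, a • ω ∈ M) : regDiff k S ≤ M := by
  rintro _ ⟨τ, rfl⟩
  have hτ : τ ∈ Submodule.span (regFun k S) (Set.range (KaehlerDifferential.D k (regFun k S))) := by
    rw [KaehlerDifferential.span_range_derivation]
    trivial
  induction hτ using Submodule.span_induction with
  | mem τ h =>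
    obtain ⟨a, rfl⟩ := h
    simpa [KaehlerDifferential.map_D] using hD a a.2
  | zero => simp
  | add τ τ' _ _ h h' => rw [map_add]; exact M.add_mem h h'
  | smul a τ _ h =>
    have h1 := hM a a.2 _ h
    have h2 := map_smul (KaehlerDifferential.map k k (regFun k S) F) a τ
    exact h2 ▸ h1

end RegDiff

namespace IsKummer

variable {k F : Type*} [Field k] [Field F] [Algebra k F] {n r : ℕ} {ρ : Fin r → k} {l : Fin r → ℕ}
  {x y : F} (H : IsKummer n ρ l x y)
include H

theorem natCast_ne_zero : (n : F) ≠ 0 := by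
  rw [← map_natCast (algebraMap k F)]
  exact (_root_.map_ne_zero _).2 H.cast_ne_zero

theorem exists_dvd_add (μ : ℕ) : ∃ ν, n ∣ μ + ν :=
  ⟨(n - 1) * μ, μ, by
    obtain ⟨m, rfl⟩ := Nat.exists_eq_succ_of_ne_zero H.ne_zero
    rw [Nat.succ_sub_one, Nat.succ_mul, add_comm]⟩

theorem wfun_smul_D {μ ν : ℕ} (h : n ∣ μ + ν) :
    wfun n ρ l x y μ • KaehlerDifferential.D k F x =
      aeval x (ramPoly ρ l n μ) • omegaOne n ρ l x y ν := by
  rw [omegaOne_eq, smul_smul, ← H.wfun_mul_wfun_of_dvd h,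
    mul_inv_cancel_right₀ (H.wfun_ne_zero ν)]

theorem D_wfun {μ ν : ℕ} (h : n ∣ μ + ν) :
    KaehlerDifferential.D k F (wfun n ρ l x y μ) =
      (n : k)⁻¹ • aeval x (dlogPoly ρ l n μ) • omegaOne n ρ l x y ν := by
  rw [← H.smul_D_wfun h, Nat.cast_smul_eq_nsmul, ← Nat.cast_smul_eq_nsmul k,
    inv_smul_smul₀ H.cast_ne_zero]

theorem D_mem_span [IsAlgClosed k] {a : F} (ha : a ∈ regFun k {x}) :
    KaehlerDifferential.D k F a ∈ Submodule.span k (edif n ρ l x y '' {q | 0 ≤ q.1}) := by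
  rw [← Subalgebra.mem_toSubmodule, H.regFun_eq_span] at ha
  induction ha using Submodule.span_induction with
  | mem a h =>
    obtain ⟨⟨m, j⟩, hm, rfl⟩ := h
    obtain ⟨m, rfl⟩ := Int.eq_ofNat_of_zero_le hm
    obtain ⟨ν, hν⟩ := H.exists_dvd_add j
    have h1 : efun n ρ l x y ((m : ℕ), j) = aeval x (X ^ m : k[X]) * wfun n ρ l x y j := by
      simp [efun]
    have h2 : KaehlerDifferential.D k F (efun n ρ l x y ((m : ℕ), j)) =
        (n : k)⁻¹ • aeval x (X ^ m * dlogPoly ρ l n j) • omegaOne n ρ l x y ν +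
          aeval x (derivative (X ^ m : k[X]) * ramPoly ρ l n j) • omegaOne n ρ l x y ν := by
      rw [h1, Derivation.leibniz, Derivation.map_aeval, H.D_wfun hν, smul_comm (wfun n ρ l x y j),
        H.wfun_smul_D hν, smul_comm _ (n : k)⁻¹, smul_smul (aeval x _), ← map_mul,
        smul_smul (aeval x _), ← map_mul]
    erw [h2]
    exact Submodule.add_mem _ (Submodule.smul_mem _ _ (aeval_smul_omegaOne_mem _ _))
      (aeval_smul_omegaOne_mem _ _)
  | zero => simp
  | add a b _ _ h h' => rw [map_add]; exact Submodule.add_mem _ h h'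
  | smul c a _ h => rw [Derivation.map_smul]; exact Submodule.smul_mem _ _ h

theorem wfun_smul_omegaOne (μ ν : ℕ) : ∃ (p : k[X]) (κ : ℕ),
    wfun n ρ l x y μ • omegaOne n ρ l x y ν = aeval x p • omegaOne n ρ l x y κ := by
  obtain ⟨m, hm⟩ := H.exists_dvd_add μ
  have h1 := H.wfun_mul_wfun μ (m + ν)
  rw [← add_assoc, H.wfun_eq_of_modEq (μ := μ + m + ν) (ν := ν)
    (by simpa using (Nat.modEq_zero_iff_dvd.2 hm).add_right ν)] at h1
  refine ⟨prodPow ρ (carry l n μ (m + ν)), m + ν, ?_⟩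
  have h2 := H.wfun_ne_zero ν
  have h3 := H.wfun_ne_zero (m + ν)
  rw [omegaOne_eq, omegaOne_eq, smul_smul, smul_smul]
  congr 1
  rw [← div_eq_mul_inv, ← div_eq_mul_inv, div_eq_div_iff h2 h3]
  exact h1

theorem smul_mem_span [IsAlgClosed k] {a : F} (ha : a ∈ regFun k {x}) {ω : Ω[F⁄k]}
    (hω : ω ∈ Submodule.span k (edif n ρ l x y '' {q | 0 ≤ q.1})) :
    a • ω ∈ Submodule.span k (edif n ρ l x y '' {q | 0 ≤ q.1}) := by
  rw [← Subalgebra.mem_toSubmodule, H.regFun_eq_span] at ha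
  induction ha using Submodule.span_induction with
  | mem a h =>
    obtain ⟨⟨m, j⟩, hm, rfl⟩ := h
    obtain ⟨m, rfl⟩ := Int.eq_ofNat_of_zero_le hm
    induction hω using Submodule.span_induction with
    | mem ω h =>
      obtain ⟨⟨m', j'⟩, hm', rfl⟩ := h
      obtain ⟨m', rfl⟩ := Int.eq_ofNat_of_zero_le hm'
      obtain ⟨p, κ, h⟩ := H.wfun_smul_omegaOne j j'
      have h1 : efun n ρ l x y ((m : ℕ), j) • edif n ρ l x y ((m' : ℕ), j') =
          aeval x (X ^ (m + m') * p) • omegaOne n ρ l x y κ := by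
        rw [map_mul, mul_smul, ← h, efun, edif, smul_smul, smul_smul]
        congr 1
        simp [pow_add]
        ring
      exact h1 ▸ aeval_smul_omegaOne_mem _ _
    | zero => simp
    | add ω τ _ _ h h' => rw [smul_add]; exact Submodule.add_mem _ h h'
    | smul c ω _ h => rw [smul_comm]; exact Submodule.smul_mem _ _ h
  | zero => simp
  | add a b _ _ h h' => rw [add_smul]; exact Submodule.add_mem _ h h'
  | smul c a _ h => rw [smul_assoc]; exact Submodule.smul_mem _ _ h

/-- At each point of the line some polynomial multiple of `w_κ⁻¹ dx` with nonzero coefficient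
is regular. -/
theorem exists_eval_ne_zero (κ : ℕ) (c : k) : ∃ p : k[X], p.eval c ≠ 0 ∧
    aeval x p • omegaOne n ρ l x y κ ∈ regDiff k {x} := by
  by_cases hc : (ramPoly ρ l n κ).eval c = 0
  · rw [ramPoly, eval_prod, Finset.prod_eq_zero_iff] at hc
    obtain ⟨i, hi, hc⟩ := hc
    obtain rfl : c = ρ i := by simpa [sub_eq_zero] using hc
    have hκ : rem n l κ i ≠ 0 := by simpa [ramSet] using hi
    have hlt := rem_lt l H.ne_zero κ i
    -- w_μ is a uniformizer above `ρ_i`, so dw_μ generates the differentials there. With ν ≡ -(μ +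
    -- κ), the product n w_ν dw_μ is a polynomial multiple of w_κ⁻¹ dx.
    obtain ⟨μ, hμ⟩ := exists_rem_eq_one l H.ne_zero i (by omega)
    obtain ⟨μ', hμ'⟩ := H.exists_dvd_add μ
    obtain ⟨ν, hν⟩ := H.exists_dvd_add (μ + κ)
    have h1 := H.wfun_mul_wfun ν κ
    rw [H.wfun_eq_of_modEq (μ := ν + κ) (ν := μ')] at h1
    swap
    · apply Nat.ModEq.add_left_cancel' μ
      have h2 : n ∣ μ + (ν + κ) := by
        convert hν using 1
        ring
      exact (Nat.modEq_zero_iff_dvd.2 h2).trans (Nat.modEq_zero_iff_dvd.2 hμ').symm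
    refine ⟨dlogPoly ρ l n μ * prodPow ρ (carry l n ν κ), ?_, ?_⟩
    · have h2 : carry l n ν κ i = 0 := by
        -- With `υ(μ) = 1`, either `υ(κ) + 1 < e_i`, so `υ(ν) = e_i - 1 - υ(κ)`, or `υ(κ) + 1 =
        -- e_i`, so `υ(ν) = 0`. In both cases `υ(ν) + υ(κ) = e_i - 1`.
        apply carry_eq_zero
        have h2 := rem_add_rem (n := n) l μ κ i
        have h3 := rem_add_rem (n := n) l (μ + κ) ν i
        have h4 := rem_lt l H.ne_zero (μ + κ) i
        have h5 := rem_lt l H.ne_zero ν i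
        obtain ⟨a, ha⟩ := id hν
        rw [carry_of_dvd l H.ne_zero _ _ hν i, ha, ← zero_add (n * a), rem_add_mul, rem_zero] at h3
        rcases Nat.eq_zero_or_pos (carry l n μ κ i) with h6 | h6
        · rw [h6] at h2
          rw [if_pos (by omega)] at h3
          omega
        · have := Nat.mul_le_mul_left (ramIdx n l i) h6
          rw [if_neg (by omega)] at h3
          omega
      rw [eval_mul, eval_prodPow]
      refine mul_ne_zero (eval_dlogPoly_ne_zero ρ l H.injective H.cast_ne_zero hμ)
        (Finset.prod_ne_zero_iff.2 fun j _ => ?_)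
      by_cases hj : i = j
      · rw [← hj, h2, pow_zero]
        exact one_ne_zero
      · exact pow_ne_zero _ (sub_ne_zero.2 fun h => hj (H.injective h))
    · have h2 := (regDiff k {x}).smul_mem (n : k) (smul_mem_regDiff (H.wfun_mem_regFun ν)
        (D_mem_regDiff k (H.wfun_mem_regFun μ)))
      convert h2 using 1
      rw [H.D_wfun hμ', smul_comm _ (n : k)⁻¹, smul_inv_smul₀ H.cast_ne_zero, omegaOne_eq,
        omegaOne_eq, smul_smul, smul_smul, smul_smul, map_mul]
      congr 1
      have h3 := H.wfun_ne_zero κ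
      have h4 := H.wfun_ne_zero μ'
      field_simp
      linear_combination -(aeval x (dlogPoly ρ l n μ)) * h1
  · obtain ⟨μ, hμ⟩ := H.exists_dvd_add κ
    refine ⟨_, hc, ?_⟩
    have h1 : aeval x (ramPoly ρ l n κ) • omegaOne n ρ l x y κ =
        wfun n ρ l x y μ • KaehlerDifferential.D k F x := by
      rw [omegaOne_eq, smul_smul, ← H.wfun_mul_wfun_of_dvd hμ, mul_comm (wfun n ρ l x y κ),
        mul_inv_cancel_right₀ (H.wfun_ne_zero κ)]
    rw [h1]
    exact smul_mem_regDiff (H.wfun_mem_regFun μ) (D_mem_regDiff k (self_mem_regFun rfl))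

/-- The polynomials p with p w_κ⁻¹ dx regular form an ideal of k[X]. By `exists_eval_ne_zero` it has
no common zero, so over an algebraically closed field it contains 1. -/
theorem omegaOne_mem_regDiff [IsAlgClosed k] (κ : ℕ) :
    omegaOne n ρ l x y κ ∈ regDiff k {x} := by
  let N : Ideal k[X] :=
    { carrier := {p | aeval x p • omegaOne n ρ l x y κ ∈ regDiff k {x}}
      zero_mem' := by simp
      add_mem' := fun {p q} hp hq => by
        rw [Set.mem_ofPred_eq, map_add, add_smul]
        exact (regDiff k {x}).add_mem hp hq
      smul_mem' := fun p q hq => by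
        rw [Set.mem_ofPred_eq, smul_eq_mul, map_mul, mul_smul]
        exact smul_mem_regDiff (aeval_mem_regFun p) hq }
  have hN : N = ⊤ := by
    obtain ⟨g, hg⟩ := (IsPrincipalIdealRing.principal N).principal
    by_contra hne
    have hg' : N = Ideal.span {g} := hg
    rw [hg', Ideal.span_singleton_eq_top] at hne
    obtain ⟨c, hc⟩ : ∃ c, g.IsRoot c := by
      by_cases h : g.degree = 0
      · exact absurd (isUnit_iff_degree_eq_zero.2 h) hne
      · exact IsAlgClosed.exists_root g h
    obtain ⟨p, hp, hpN⟩ := H.exists_eval_ne_zero κ c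
    have hp' : p ∈ N := hpN
    rw [hg', Ideal.mem_span_singleton] at hp'
    exact hp (dvd_iff_isRoot.1 ((dvd_iff_isRoot.2 hc).trans hp'))
  have h1 : (1 : k[X]) ∈ N := hN ▸ Submodule.mem_top
  have h2 : aeval x (1 : k[X]) • omegaOne n ρ l x y κ ∈ regDiff k {x} := h1
  simpa using h2

theorem regDiff_eq_span [IsAlgClosed k] : regDiff k {x} =
    Submodule.span k (edif n ρ l x y '' {q | 0 ≤ q.1}) := by
  apply le_antisymm
  · exact regDiff_le (fun a ha => H.D_mem_span ha) fun a ha ω hω => H.smul_mem_span ha hω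
  · rw [Submodule.span_le]
    rintro _ ⟨⟨m, j⟩, hm, rfl⟩
    obtain ⟨m, rfl⟩ := Int.eq_ofNat_of_zero_le hm
    have := smul_mem_regDiff ((regFun k {x}).pow_mem (self_mem_regFun rfl) m)
      (H.omegaOne_mem_regDiff j)
    simpa [edif] using this

end IsKummer

/-! ### The coordinate 1/x, the open set U_0 and the intersection. -/

section Inversion

variable {k F : Type*} [Field k] [Field F] [Algebra k F] {n r : ℕ} {ρ : Fin r → k} {l : Fin r → ℕ}
  {x y : F}

/-- The exponents of the equation of the cover in the coordinate `1 / x`. -/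
def invExp (ρ : Fin r → k) (a : Fin r → ℕ) (i : Fin r) : ℕ :=
  open Classical in if ρ i = 0 then 0 else a i

/-- For ρ ≠ 0, 1/x - 1/ρ = -ρ⁻¹ (x - ρ)/x. For ρ = 0 the factor x/x is trivial, which is why
`invExp` gives it exponent 0; the convention `0⁻¹ = 0` keeps the inverted roots distinct. -/
theorem aeval_inv_prodPow (hx : x ≠ 0) (ρ : Fin r → k) (a : Fin r → ℕ) : ∃ u : k, u ≠ 0 ∧
    aeval x⁻¹ (prodPow (fun i => (ρ i)⁻¹) (invExp ρ a)) =
      u • ((x ^ ∑ i, a i)⁻¹ * aeval x (prodPow ρ a)) := by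
  classical
  refine ⟨∏ i, if ρ i = 0 then 1 else (-(ρ i)⁻¹) ^ a i, Finset.prod_ne_zero_iff.2 fun i _ => ?_, ?_⟩
  · split_ifs with h
    · exact one_ne_zero
    · exact pow_ne_zero _ (neg_ne_zero.2 (inv_ne_zero h))
  · rw [Algebra.smul_def, map_prod, prodPow, prodPow, map_prod, map_prod, ← Finset.prod_pow_eq_pow_sum,
      ← Finset.prod_inv_distrib, ← Finset.prod_mul_distrib, ← Finset.prod_mul_distrib]
    refine Finset.prod_congr rfl fun i _ => ?_
    unfold invExp
    by_cases h : ρ i = 0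
    · simp [h, hx]
    · have h' : algebraMap k F (ρ i) ≠ 0 := (_root_.map_ne_zero _).2 h
      simp only [h, if_false, map_pow, map_sub, aeval_X, aeval_C, map_neg, map_inv₀]
      rw [← inv_pow, ← mul_pow, ← mul_pow]
      congr 1
      field_simp
      ring

theorem quo_invExp (ρ : Fin r → k) (μ : ℕ) :
    quo n (invExp ρ l) μ = invExp ρ (quo n l μ) := by
  funext i
  by_cases h : ρ i = 0 <;> simp [quo, lam, ramIdx, numPts, invExp, h]

theorem span_image_eq {M ι ι' : Type*} [AddCommGroup M] [Module k M] {f : ι → M} {g : ι' → M}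
    {S : Set ι} {T : Set ι'} (h : ∀ a ∈ S, ∃ b ∈ T, ∃ c : k, f a = c • g b)
    (h' : ∀ b ∈ T, ∃ a ∈ S, ∃ c : k, g b = c • f a) :
    Submodule.span k (f '' S) = Submodule.span k (g '' T) := by
  apply le_antisymm <;> rw [Submodule.span_le]
  · rintro _ ⟨a, ha, rfl⟩
    obtain ⟨b, hb, c, hc⟩ := h a ha
    rw [hc]
    exact Submodule.smul_mem _ _ (Submodule.subset_span ⟨b, hb, rfl⟩)
  · rintro _ ⟨a, ha, rfl⟩
    obtain ⟨b, hb, c, hc⟩ := h' a ha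
    rw [hc]
    exact Submodule.smul_mem _ _ (Submodule.subset_span ⟨b, hb, rfl⟩)

namespace IsKummer

variable (H : IsKummer n ρ l x y)
include H

/-- Dividing y by x^L turns y^n = f(x) into an equation in 1/x up to the constant u, absorbed by an
n-th root c. All results on U_∞ thus apply to U_0. -/
theorem inversion [IsAlgClosed k] {L : ℕ} (hL : ∑ i, l i = n * L) : ∃ c : k, c ≠ 0 ∧
    IsKummer n (fun i => (ρ i)⁻¹) (invExp ρ l) x⁻¹ (c • ((x ^ L)⁻¹ * y)) := by
  have hx := H.x_ne_zero
  obtain ⟨u, hu, h⟩ := aeval_inv_prodPow hx ρ l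
  obtain ⟨c, hc⟩ := IsAlgClosed.exists_pow_nat_eq u (Nat.pos_of_ne_zero H.ne_zero)
  have hc0 : c ≠ 0 := by
    rintro rfl
    exact hu (by rw [← hc, zero_pow H.ne_zero])
  have hadj : IntermediateField.adjoin k {x⁻¹} = IntermediateField.adjoin k {x} := by
    apply le_antisymm <;> rw [IntermediateField.adjoin_simple_le_iff]
    · exact inv_mem (IntermediateField.mem_adjoin_simple_self k x)
    · simpa using inv_mem (IntermediateField.mem_adjoin_simple_self k x⁻¹)
  refine ⟨c, hc0, ?_, H.cast_ne_zero, fun i j hij => H.injective (inv_injective hij), ?_, ?_, ?_⟩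
  · intro h0
    exact H.transcendental (by simpa using h0.inv)
  · rw [ff_eq, h, _root_.smul_pow, hc, mul_pow, H.pow_eq, inv_pow, ← pow_mul, hL, mul_comm n L, ff_eq]
  · intro b
    obtain ⟨a, ha, hb⟩ := H.exists_sum b
    refine ⟨fun j => a j * (c⁻¹ ^ j • (x ^ L) ^ j), fun j => ?_, ?_⟩
    · rw [hadj]
      have hxm := IntermediateField.mem_adjoin_simple_self k x
      exact mul_mem (ha j) (IntermediateField.smul_mem _ (pow_mem (pow_mem hxm _) _))
    · rw [hb]
      refine Finset.sum_congr rfl fun j _ => ?_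
      beta_reduce
      rw [_root_.smul_pow, mul_pow, mul_smul_comm, mul_smul_comm, smul_mul_assoc, smul_smul,
        ← mul_pow, mul_inv_cancel₀ hc0, one_pow, one_smul, inv_pow]
      field_simp
  · obtain ⟨ζ, hζ, σ, hσx, hσy⟩ := H.exists_algHom
    refine ⟨ζ, hζ, σ, by rw [map_inv₀, hσx], ?_⟩
    rw [map_smul, map_mul, map_inv₀, map_pow, hσx, hσy, mul_smul_comm, smul_comm]

theorem wfun_inversion {L : ℕ} (hL : ∑ i, l i = n * L) {c : k} (hc : c ≠ 0) (μ : ℕ) :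
    ∃ v : k, v ≠ 0 ∧
      wfun n (fun i => (ρ i)⁻¹) (invExp ρ l) x⁻¹ (c • ((x ^ L)⁻¹ * y)) μ =
        v • (x ^ (-(tt n l μ : ℤ)) * wfun n ρ l x y μ) := by
  have hx := H.x_ne_zero
  obtain ⟨u, hu, h⟩ := aeval_inv_prodPow hx ρ (quo n l μ)
  refine ⟨c ^ μ * u⁻¹, mul_ne_zero (pow_ne_zero _ hc) (inv_ne_zero hu), ?_⟩
  have hg := H.aeval_ne_zero (prodPow_ne_zero ρ (quo n l μ))
  have hu' : algebraMap k F u ≠ 0 := (_root_.map_ne_zero _).2 hu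
  rw [wfun, gg_eq, quo_invExp, h, wfun, gg_eq, tt_eq_sub l H.ne_zero hL, neg_sub, zpow_sub₀ hx,
    ← Nat.cast_sum, ← Nat.cast_mul, zpow_natCast, zpow_natCast, _root_.smul_pow, mul_pow, inv_pow,
    ← pow_mul, mul_comm L, Algebra.smul_def, Algebra.smul_def, Algebra.smul_def, map_mul, map_inv₀]
  field_simp

theorem regFun_inv_eq_span [IsAlgClosed k] {L : ℕ} (hL : ∑ i, l i = n * L) :
    Subalgebra.toSubmodule (regFun k {x⁻¹}) =
      Submodule.span k (efun n ρ l x y '' {q | q.1 ≤ -tt n l q.2}) := by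
  obtain ⟨c, hc, H'⟩ := H.inversion hL
  have hx := H.x_ne_zero
  have key : ∀ (m : ℤ) (j : ℕ), ∃ v : k, v ≠ 0 ∧
      efun n (fun i => (ρ i)⁻¹) (invExp ρ l) x⁻¹ (c • ((x ^ L)⁻¹ * y)) (m, j) =
        v • efun n ρ l x y (-m - tt n l j, j) := by
    intro m j
    obtain ⟨v, hv, h⟩ := H.wfun_inversion hL hc j
    refine ⟨v, hv, ?_⟩
    rw [efun, efun, h, mul_smul_comm, ← mul_assoc, sub_eq_add_neg, zpow_add₀ hx, inv_zpow']
  rw [H'.regFun_eq_span]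
  apply span_image_eq
  · rintro ⟨m, j⟩ hm
    obtain ⟨v, hv, h⟩ := key m j
    exact ⟨_, by simp only [Set.mem_ofPred_eq] at hm ⊢; omega, v, h⟩
  · rintro ⟨m, j⟩ hm
    obtain ⟨v, hv, h⟩ := key (-m - tt n l j) j
    refine ⟨(-m - tt n l j, j), ?_, v⁻¹, ?_⟩
    rotate_left
    · rw [h, inv_smul_smul₀ hv, neg_sub, sub_neg_eq_add, add_sub_cancel_left]
    · simp only [Set.mem_ofPred_eq] at hm ⊢; omega

theorem regDiff_inv_eq_span [IsAlgClosed k] {L : ℕ} (hL : ∑ i, l i = n * L) :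
    regDiff k {x⁻¹} =
      Submodule.span k (edif n ρ l x y '' {q | q.1 ≤ tt n l q.2 - 2}) := by
  obtain ⟨c, hc, H'⟩ := H.inversion hL
  have hx := H.x_ne_zero
  have key : ∀ (m : ℤ) (j : ℕ), ∃ v : k, v ≠ 0 ∧
      edif n (fun i => (ρ i)⁻¹) (invExp ρ l) x⁻¹ (c • ((x ^ L)⁻¹ * y)) (m, j) =
        v • edif n ρ l x y (-m + tt n l j - 2, j) := by
    intro m j
    obtain ⟨v, hv, h⟩ := H.wfun_inversion hL hc j
    -- The sign and the shift by 2 come from d(1/x) = -x^{-2} dx.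
    refine ⟨-v⁻¹, neg_ne_zero.2 (inv_ne_zero hv), ?_⟩
    rw [edif, edif, omegaOne_eq, omegaOne_eq, h, Derivation.leibniz_inv, smul_smul, smul_smul,
      smul_smul, ← smul_assoc]
    congr 1
    rw [zpow_neg, zpow_natCast, sub_eq_add_neg, zpow_add₀ hx, zpow_add₀ hx, inv_zpow', zpow_natCast,
      Algebra.smul_def, Algebra.smul_def, map_neg, map_inv₀]
    have hv' : algebraMap k F v ≠ 0 := (_root_.map_ne_zero _).2 hv
    have := H.wfun_ne_zero j
    have h2 : x ^ (-2 : ℤ) = (x ^ 2)⁻¹ := by rw [zpow_neg]; norm_cast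
    rw [h2]
    field_simp
  rw [H'.regDiff_eq_span]
  apply span_image_eq
  · rintro ⟨m, j⟩ hm
    obtain ⟨v, hv, h⟩ := key m j
    exact ⟨_, by simp only [Set.mem_ofPred_eq] at hm ⊢; omega, v, h⟩
  · rintro ⟨m, j⟩ hm
    obtain ⟨v, hv, h⟩ := key (-m + tt n l j - 2) j
    refine ⟨(-m + tt n l j - 2, j), ?_, v⁻¹, ?_⟩
    rotate_left
    · rw [h, inv_smul_smul₀ hv]
      congr 2
      ring
    · simp only [Set.mem_ofPred_eq] at hm ⊢; omega

theorem exists_pow_mul_mem_adjoin {a : F} (ha : a ∈ Algebra.adjoin k {x, x⁻¹}) :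
    ∃ N : ℕ, x ^ N * a ∈ Algebra.adjoin k {x} := by
  have hx := H.x_ne_zero
  have hx' := Algebra.self_mem_adjoin_singleton k x
  induction ha using Algebra.adjoin_induction with
  | mem a h =>
    obtain rfl | rfl := h
    · exact ⟨0, by simp⟩
    · exact ⟨1, by simp [hx]⟩
  | algebraMap c => exact ⟨0, by simp⟩
  | add a b _ _ h h' =>
    obtain ⟨N, h⟩ := h
    obtain ⟨N', h'⟩ := h'
    refine ⟨N + N', ?_⟩
    rw [show x ^ (N + N') * (a + b) = x ^ N' * (x ^ N * a) + x ^ N * (x ^ N' * b) by ring]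
    exact add_mem (mul_mem (pow_mem hx' _) h) (mul_mem (pow_mem hx' _) h')
  | mul a b _ _ h h' =>
    obtain ⟨N, h⟩ := h
    obtain ⟨N', h'⟩ := h'
    refine ⟨N + N', ?_⟩
    rw [show x ^ (N + N') * (a * b) = (x ^ N * a) * (x ^ N' * b) by ring]
    exact mul_mem h h'

/-- Choose x^N clearing every coefficient of a monic equation for b; scaling its roots by x^N
multiplies each lower coefficient by at least x^N and keeps the equation monic. -/
theorem exists_pow_mul_mem_regFun {b : F} (hb : b ∈ regFun k {x, x⁻¹}) :
    ∃ N : ℕ, x ^ N * b ∈ regFun k {x} := by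
  obtain ⟨p, hp, hpb⟩ : IsIntegral (Algebra.adjoin k {x, x⁻¹}) b := hb
  choose! e he using fun (a : Algebra.adjoin k {x, x⁻¹}) => H.exists_pow_mul_mem_adjoin a.2
  have hxA := Algebra.self_mem_adjoin_singleton k x
  set N := ∑ i ∈ p.support, e (p.coeff i)
  set P : F[X] := p.map (algebraMap (Algebra.adjoin k {x, x⁻¹}) F)
  have hP : P.Monic := hp.map _
  have hcoeff : ∀ i, x ^ N * P.coeff i ∈ Algebra.adjoin k {x} := by
    intro i
    rw [coeff_map]
    by_cases hi : i ∈ p.support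
    · have hN : e (p.coeff i) ≤ N := Finset.single_le_sum (f := fun i => e (p.coeff i))
        (fun _ _ => Nat.zero_le _) hi
      rw [← Nat.sub_add_cancel hN, pow_add, mul_assoc]
      exact mul_mem (pow_mem hxA _) (he _)
    · rw [notMem_support_iff.1 hi, map_zero, mul_zero]
      exact zero_mem _
  have hlift : P.scaleRoots (x ^ N) ∈ lifts (algebraMap (Algebra.adjoin k {x}) F) := by
    rw [lifts_iff_coeff_lifts]
    intro i
    rw [coeff_scaleRoots]
    rcases lt_or_ge i P.natDegree with h | h
    · obtain ⟨d, hd⟩ := Nat.exists_eq_succ_of_ne_zero (Nat.sub_ne_zero_of_lt h)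
      rw [hd, pow_succ', ← mul_assoc, mul_comm (P.coeff i)]
      exact ⟨⟨_, mul_mem (hcoeff i) (pow_mem (pow_mem hxA N) d)⟩, rfl⟩
    · rw [Nat.sub_eq_zero_of_le h, pow_zero, mul_one]
      rcases h.eq_or_lt with h | h
      · rw [← h, hP.coeff_natDegree]
        exact ⟨1, map_one _⟩
      · rw [coeff_eq_zero_of_natDegree_lt h]
        exact ⟨0, map_zero _⟩
  obtain ⟨Q, hQ, -, hQm⟩ := lifts_and_natDegree_eq_and_monic hlift
    ((monic_scaleRoots_iff _).2 hP)
  refine ⟨N, Q, hQm, ?_⟩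
  rw [eval₂_eq_eval_map, hQ]
  have h1 : P.eval b = 0 := by rw [← hpb, eval₂_eq_eval_map]
  exact scaleRoots_eval₂_eq_zero (f := RingHom.id F) (by rwa [eval₂_id])

theorem regFun_inter_eq_span [IsAlgClosed k] : Subalgebra.toSubmodule (regFun k {x, x⁻¹}) =
    Submodule.span k (Set.range (efun n ρ l x y)) := by
  have hx := H.x_ne_zero
  apply le_antisymm
  · intro b hb
    obtain ⟨N, hN⟩ := H.exists_pow_mul_mem_regFun hb
    rw [← Subalgebra.mem_toSubmodule, H.regFun_eq_span] at hN
    have h1 : b = LinearMap.mulLeft k (x ^ N)⁻¹ (x ^ N * b) := by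
      simp [hx]
    rw [h1]
    have h2 := Submodule.mem_map_of_mem (f := LinearMap.mulLeft k (x ^ N)⁻¹) hN
    rw [Submodule.map_span] at h2
    refine Submodule.span_mono ?_ h2
    rintro _ ⟨_, ⟨⟨m, j⟩, -, rfl⟩, rfl⟩
    refine ⟨(-N + m, j), ?_⟩
    rw [LinearMap.mulLeft_apply, efun, efun, zpow_add₀ hx, zpow_neg, zpow_natCast, mul_assoc]
  · rw [Submodule.span_le]
    rintro _ ⟨⟨m, j⟩, rfl⟩
    refine (regFun k {x, x⁻¹}).mul_mem ?_ (regFun_mono k (by simp) (H.wfun_mem_regFun j))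
    obtain ⟨m, rfl | rfl⟩ := m.eq_nat_or_neg
    · simpa using (regFun k {x, x⁻¹}).pow_mem (self_mem_regFun (by simp)) m
    · simpa using (regFun k {x, x⁻¹}).pow_mem (self_mem_regFun (a := x⁻¹) (by simp)) m

end IsKummer

end Inversion

/-! ### Linear independence of the monomial functions and differentials. -/

theorem linearIndependent_zpow {k F : Type*} [Field k] [Field F] [Algebra k F] {x : F}
    (hx : Transcendental k x) : LinearIndependent k fun m : ℤ => x ^ m := by
  have hx0 : x ≠ 0 := by
    rintro rfl
    exact hx isAlgebraic_zero
  rw [linearIndependent_iff']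
  intro s g hs i hi
  obtain ⟨N, hN⟩ : ∃ N : ℕ, ∀ j ∈ s, 0 ≤ j + N := by
    refine ⟨∑ j ∈ s, j.natAbs, fun j hj => ?_⟩
    have := Finset.single_le_sum (f := Int.natAbs) (fun _ _ => Nat.zero_le _) hj
    omega
  have h1 : aeval x (∑ j ∈ s, monomial (j + N).toNat (g j)) = 0 := by
    calc _ = x ^ N * ∑ j ∈ s, g j • x ^ j := by
          rw [map_sum, Finset.mul_sum]
          refine Finset.sum_congr rfl fun j hj => ?_
          rw [aeval_monomial, ← zpow_natCast, Int.toNat_of_nonneg (hN j hj), zpow_add₀ hx0,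
            zpow_natCast, Algebra.smul_def]
          ring
      _ = 0 := by rw [hs, mul_zero]
  have h2 := congrArg (fun p => coeff p (i + N).toNat) (transcendental_iff.1 hx _ h1)
  simp only [finsetSum_coeff, coeff_monomial, coeff_zero] at h2
  rw [Finset.sum_eq_single_of_mem i hi, if_pos rfl] at h2
  · exact h2
  · intro j hj hji
    refine if_neg fun h => hji ?_
    have := hN j hj
    have := hN i hi
    omega

section Setup

variable {k F : Type*} [Field k] [Field F] [Algebra k F] [Algebra (RatFunc k) F]
  [IsScalarTower k (RatFunc k) F] {n r : ℕ} {ρ : Fin r → k} {l : Fin r → ℕ} {x y : F}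

theorem transcendental_of_eq (hx : x = algebraMap (RatFunc k) F RatFunc.X) :
    Transcendental k x := by
  rw [hx]
  exact (transcendental_algebraMap_iff (algebraMap (RatFunc k) F).injective).2
    RatFunc.transcendental_X

theorem algebraMap_mem_adjoin (hx : x = algebraMap (RatFunc k) F RatFunc.X) (a : RatFunc k) :
    algebraMap (RatFunc k) F a ∈ IntermediateField.adjoin k {x} := by
  have ha : a ∈ IntermediateField.adjoin k {(RatFunc.X : RatFunc k)} := by
    rw [RatFunc.adjoin_X]
    trivial
  have h1 := IntermediateField.adjoin_map k {(RatFunc.X : RatFunc k)}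
    (IsScalarTower.toAlgHom k (RatFunc k) F)
  rw [Set.image_singleton] at h1
  have h2 : (IsScalarTower.toAlgHom k (RatFunc k) F) RatFunc.X = x := hx.symm
  rw [h2] at h1
  rw [← h1]
  exact ⟨a, ha, rfl⟩

theorem exists_powerBasis {k F : Type*} [Field k] [Field F] [Algebra (RatFunc k) F] {n : ℕ} {y : F}
    (hn : (n : k) ≠ 0) (hgen : IntermediateField.adjoin (RatFunc k) {y} = ⊤)
    (hdeg : Module.finrank (RatFunc k) F = n) :
    ∃ pb : PowerBasis (RatFunc k) F, pb.gen = y ∧ pb.dim = n := by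
  have hn0 : n ≠ 0 := fun h => hn (by simp [h])
  have : FiniteDimensional (RatFunc k) F := Module.finite_of_finrank_pos (by omega)
  have hy : IsIntegral (RatFunc k) y := IsIntegral.of_finite _ _
  have h1 : Algebra.adjoin (RatFunc k) {y} = ⊤ := by
    rw [← IntermediateField.adjoin_simple_toSubalgebra_of_isAlgebraic hy.isAlgebraic, hgen,
      IntermediateField.top_toSubalgebra]
  refine ⟨PowerBasis.ofAdjoinEqTop hy h1, by simp, ?_⟩
  rw [← hdeg, PowerBasis.finrank]

theorem minpoly_eq (hx : x = algebraMap (RatFunc k) F RatFunc.X)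
    (hy : y ^ n = aeval x (ff ρ l)) {pb : PowerBasis (RatFunc k) F} (hpb : pb.gen = y)
    (hdim : pb.dim = n) (hn : n ≠ 0) :
    minpoly (RatFunc k) y = X ^ n - C (aeval RatFunc.X (ff ρ l)) := by
  have hxa : aeval x (ff ρ l) = algebraMap (RatFunc k) F (aeval RatFunc.X (ff ρ l)) := by
    rw [hx]
    exact aeval_algebraMap_apply F _ _
  refine (eq_of_monic_of_dvd_of_natDegree_le (minpoly.monic ?_) (monic_X_pow_sub_C _ hn)
    (minpoly.dvd _ _ ?_) ?_).symm
  · exact hpb ▸ pb.isIntegral_gen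
  · simp [hy, hxa]
  · rw [natDegree_X_pow_sub_C, ← hdim, ← hpb, pb.natDegree_minpoly]

theorem isKummer_of_finrank [IsAlgClosed k] (hn : (n : k) ≠ 0) (hρ : Function.Injective ρ)
    (hx : x = algebraMap (RatFunc k) F RatFunc.X) (hy : y ^ n = aeval x (ff ρ l))
    (hgen : IntermediateField.adjoin (RatFunc k) {y} = ⊤)
    (hdeg : Module.finrank (RatFunc k) F = n) : IsKummer n ρ l x y := by
  have hn0 : n ≠ 0 := fun h => hn (by simp [h])
  obtain ⟨pb, hpb, hdim⟩ := exists_powerBasis hn hgen hdeg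
  refine ⟨transcendental_of_eq hx, hn, hρ, hy, fun b => ?_, ?_⟩
  · refine ⟨fun j => if h : j < pb.dim then algebraMap _ F (pb.basis.repr b ⟨j, h⟩) else 0,
      fun j => ?_, ?_⟩
    · beta_reduce
      split_ifs
      · exact algebraMap_mem_adjoin hx _
      · exact zero_mem _
    · conv_lhs => rw [← pb.basis.sum_repr b]
      rw [← hdim, Finset.sum_range]
      refine Finset.sum_congr rfl fun j _ => ?_
      beta_reduce
      rw [dif_pos j.2, pb.basis_eq_pow, hpb, Algebra.smul_def]
  · have : NeZero (n : k) := ⟨hn⟩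
    obtain ⟨ζ, hζ⟩ := HasEnoughRootsOfUnity.exists_primitiveRoot k n
    have h1 : aeval (ζ • y) (minpoly (RatFunc k) pb.gen) = 0 := by
      have h2 : aeval y (minpoly (RatFunc k) y) = 0 := minpoly.aeval _ _
      rw [hpb]
      rw [minpoly_eq hx hy hpb hdim hn0] at h2 ⊢
      simpa [_root_.smul_pow, hζ.pow_eq_one] using h2
    refine ⟨ζ, hζ, (pb.lift (ζ • y) h1).restrictScalars k, ?_, ?_⟩
    · rw [hx]
      exact (pb.lift (ζ • y) h1).commutes _
    · have h2 := pb.lift_gen (ζ • y) h1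
      rwa [hpb] at h2

theorem linearIndependent_zpow_mul (hx : x = algebraMap (RatFunc k) F RatFunc.X) {v : Fin n → F}
    (hv : LinearIndependent (RatFunc k) v) :
    LinearIndependent k fun q : ℤ × Fin n => x ^ q.1 * v q.2 := by
  have h := linearIndependent_smul (linearIndependent_zpow (RatFunc.transcendental_X (K := k))) hv
  convert h using 2 with q
  rw [Algebra.smul_def, map_zpow₀, hx]

theorem linearIndependent_aeval_mul (hx : x = algebraMap (RatFunc k) F RatFunc.X) {v : Fin n → F}
    (hv : LinearIndependent (RatFunc k) v) {p : Fin n → F} (hp : ∀ j, p j ≠ 0)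
    (hp' : ∀ j, p j ∈ IntermediateField.adjoin k {x}) :
    LinearIndependent (RatFunc k) fun j => p j * v j := by
  have h1 : ∀ j, ∃ a : (RatFunc k)ˣ, algebraMap (RatFunc k) F a = p j := by
    intro j
    obtain ⟨P, Q, h⟩ := (IntermediateField.mem_adjoin_simple_iff k _).1 (hp' j)
    have h2 : algebraMap (RatFunc k) F (aeval RatFunc.X P / aeval RatFunc.X Q) = p j := by
      rw [h, map_div₀, hx, aeval_algebraMap_apply, aeval_algebraMap_apply]
    refine ⟨Units.mk0 _ fun h0 => hp j ?_, h2⟩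
    rw [← h2, h0, map_zero]
  choose a ha using h1
  convert hv.units_smul a using 2 with j
  simp [Units.smul_def, Algebra.smul_def, ha]

theorem linearIndependent_pow_gen {k F : Type*} [Field k] [Field F] [Algebra (RatFunc k) F] {n : ℕ}
    {y : F} (hn : (n : k) ≠ 0)
    (hgen : IntermediateField.adjoin (RatFunc k) {y} = ⊤)
    (hdeg : Module.finrank (RatFunc k) F = n) :
    LinearIndependent (RatFunc k) fun j : Fin n => y ^ (j : ℕ) := by
  obtain ⟨pb, rfl, rfl⟩ := exists_powerBasis hn hgen hdeg
  have h := pb.basis.linearIndependent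
  rwa [pb.coe_basis] at h

theorem linearIndependent_efun (H : IsKummer n ρ l x y)
    (hx : x = algebraMap (RatFunc k) F RatFunc.X)
    (hgen : IntermediateField.adjoin (RatFunc k) {y} = ⊤)
    (hdeg : Module.finrank (RatFunc k) F = n) :
    LinearIndependent k fun q : ℤ × Fin n => efun n ρ l x y (q.1, q.2) := by
  refine linearIndependent_zpow_mul hx (v := fun j => wfun n ρ l x y j) ?_
  have h1 := linearIndependent_pow_gen H.cast_ne_zero hgen hdeg
  have h2 := linearIndependent_aeval_mul hx h1 (p := fun j => (aeval x (gg n ρ l j))⁻¹)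
    (fun j => inv_ne_zero (H.aeval_ne_zero (prodPow_ne_zero ρ _)))
    (fun j => inv_mem ((IntermediateField.mem_adjoin_simple_iff k _).2 ⟨_, 1, by simp; rfl⟩))
  convert h2 using 2 with j
  rw [wfun, div_eq_inv_mul]

theorem linearIndependent_edif (H : IsKummer n ρ l x y)
    (hx : x = algebraMap (RatFunc k) F RatFunc.X)
    (hgen : IntermediateField.adjoin (RatFunc k) {y} = ⊤)
    (hdeg : Module.finrank (RatFunc k) F = n) (hD : KaehlerDifferential.D k F x ≠ 0) :
    LinearIndependent k fun q : ℤ × Fin n => edif n ρ l x y (q.1, q.2) := by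
  have h1 := (linearIndependent_pow_gen H.cast_ne_zero hgen hdeg).comp _ Fin.rev_injective
  have hy := H.y_ne_zero
  have h2 := h1.map_injOn (LinearMap.mulLeft (RatFunc k) (y ^ (n - 1))⁻¹)
    (fun a _ b _ hab => mul_left_cancel₀ (inv_ne_zero (pow_ne_zero _ hy)) hab)
  have h3 := linearIndependent_aeval_mul hx h2 (p := fun j => aeval x (gg n ρ l j))
    (fun j => H.aeval_ne_zero (prodPow_ne_zero ρ _))
    (fun j => (IntermediateField.mem_adjoin_simple_iff k _).2 ⟨_, 1, by simp; rfl⟩)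
  have h4 := (linearIndependent_zpow_mul hx h3).map_injOn
    (LinearMap.toSpanSingleton F Ω[F⁄k] (KaehlerDifferential.D k F x) |>.restrictScalars k)
    (fun a _ b _ hab => smul_left_injective F hD hab)
  convert h4 using 2 with q
  obtain ⟨m, j⟩ := q
  -- The factor y^{-j} in w_j⁻¹ is y^{n-1-j} / y^{n-1}, so the powers of y in reversed order give
  -- the independence.
  have h5 : y ^ (n - 1) = y ^ (j : ℕ) * y ^ (Fin.rev j : ℕ) := by
    rw [← pow_add, Fin.val_rev]
    congr 1
    omega
  have h6 := pow_ne_zero (j : ℕ) hy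
  have h7 := pow_ne_zero (Fin.rev j : ℕ) hy
  rw [edif, omegaOne, smul_smul]
  simp only [Function.comp_apply, LinearMap.restrictScalars_apply,
    LinearMap.toSpanSingleton_apply, LinearMap.mulLeft_apply]
  congr 2
  rw [h5]
  field_simp

/-- k(x) is a localization of k[x], and F is separable over k(x) because n is invertible. So F is
formally étale over k[x], and Ω[F⁄k] is free of rank one on dx. -/
theorem D_ne_zero (hn : (n : k) ≠ 0)
    (hx : x = algebraMap (RatFunc k) F RatFunc.X) (hy : y ^ n = aeval x (ff ρ l))
    (hgen : IntermediateField.adjoin (RatFunc k) {y} = ⊤)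
    (hdeg : Module.finrank (RatFunc k) F = n) : KaehlerDifferential.D k F x ≠ 0 := by
  have hn0 : n ≠ 0 := fun h => hn (by simp [h])
  obtain ⟨pb, hpb, hdim⟩ := exists_powerBasis hn hgen hdeg
  have hsep : Algebra.IsSeparable (RatFunc k) F := by
    have h1 : IsSeparable (RatFunc k) y := by
      rw [IsSeparable, minpoly_eq hx hy hpb hdim hn0]
      refine separable_X_pow_sub_C _ ?_ ?_
      · rw [← map_natCast (algebraMap k (RatFunc k))]
        exact (_root_.map_ne_zero _).2 hn
      · exact fun h => prodPow_ne_zero ρ l (transcendental_iff.1 RatFunc.transcendental_X _ h)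
    have h2 := (IntermediateField.isSeparable_adjoin_simple_iff_isSeparable (RatFunc k) F).2 h1
    rw [hgen] at h2
    exact Algebra.IsSeparable.of_algHom _ _
      (IntermediateField.topEquiv (F := RatFunc k) (E := F)).symm.toAlgHom
  let _ : Algebra k[X] F := ((algebraMap (RatFunc k) F).comp (algebraMap k[X] (RatFunc k))).toAlgebra
  have : IsScalarTower k[X] (RatFunc k) F := IsScalarTower.of_algebraMap_eq fun _ => rfl
  have : IsScalarTower k k[X] F := IsScalarTower.of_algebraMap_eq fun c => by
    rw [IsScalarTower.algebraMap_apply k (RatFunc k) F]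
    rfl
  have : Algebra.FormallyEtale k[X] (RatFunc k) :=
    Algebra.FormallyEtale.of_isLocalization (nonZeroDivisors k[X])
  have : Algebra.FormallyEtale (RatFunc k) F := Algebra.FormallyEtale.of_isSeparable _ _
  have : Algebra.FormallyEtale k[X] F := Algebra.FormallyEtale.comp k[X] (RatFunc k) F
  intro h
  have hx' : algebraMap k[X] F X = x := by
    rw [hx, IsScalarTower.algebraMap_apply k[X] (RatFunc k) F, RatFunc.algebraMap_X]
  have h1 := KaehlerDifferential.tensorKaehlerEquivOfFormallyEtale_symm_D_algebraMap k k[X] F X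
  rw [hx', h, map_zero] at h1
  have h2 := congrArg (fun t => TensorProduct.rid k[X] F
    ((KaehlerDifferential.polynomialEquiv k).toLinearMap.lTensor F t)) h1
  simp at h2

end Setup

/-! ### From monomial descriptions to a basis of the Čech cohomology. -/

theorem span_image_inf_span_image {k M ι : Type*} [Field k] [AddCommGroup M] [Module k M]
    {v : ι → M} (hv : LinearIndependent k v) (S T : Set ι) :
    Submodule.span k (v '' S) ⊓ Submodule.span k (v '' T) = Submodule.span k (v '' (S ∩ T)) := by
  simp only [Finsupp.span_image_eq_map_linearCombination, Finsupp.supported_inter]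
  exact (Submodule.map_inf _ hv).symm

section Cech

variable {k F : Type*} [Field k] [Field F] [Algebra k F] {x : F}

/-- A criterion for classes of cocycles to form a basis of `H¹_dR(X/k)`, when regular functions and
differentials are spanned by subfamilies of linearly independent families. -/
theorem exists_basis_H1dR {ι J : Type*} [Finite J] {E : ι → F} {E' : ι → Ω[F⁄k]}
    (hE : LinearIndependent k E) (hE' : LinearIndependent k E') {S₀ S₁ T₀ T₁ : Set ι}
    (hO0 : Subalgebra.toSubmodule (O0 k x) = Submodule.span k (E '' S₀))
    (hOinf : Subalgebra.toSubmodule (Oinf k x) = Submodule.span k (E '' S₁))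
    (hO0inf : Subalgebra.toSubmodule (O0inf k x) = Submodule.span k (Set.range E))
    (hΩ0 : Omega0 k x = Submodule.span k (E' '' T₀))
    (hΩinf : OmegaInf k x = Submodule.span k (E' '' T₁))
    (hconst : ∀ i ∈ S₀ ∩ S₁, KaehlerDifferential.D k F (E i) = 0)
    {p q : J → ι} (hp : Function.Injective p) (hq : Function.Injective q)
    (hp' : Set.range p = (S₀ ∪ S₁)ᶜ) (hq' : Set.range q = T₀ ∩ T₁)
    {a δ : J → Ω[F⁄k] × Ω[F⁄k] × F} (ha : ∀ j, a j ∈ cocycles k x)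
    (ha' : ∀ j, (a j).2.2 = E (p j)) (hδ : ∀ j, δ j = (E' (q j), E' (q j), 0)) :
    ∃ (hδ' : ∀ j, δ j ∈ cocycles k x) (b : Module.Basis (J ⊕ J) k (H1dR k x)),
      (∀ j, b (Sum.inl j) = cls k x _ (ha j)) ∧ (∀ j, b (Sum.inr j) = cls k x _ (hδ' j)) := by
  have := Fintype.ofFinite J
  have hqT : ∀ j, q j ∈ T₀ ∩ T₁ := fun j => hq' ▸ Set.mem_range_self j
  have hδ' : ∀ j, δ j ∈ cocycles k x := by
    intro j
    rw [hδ]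
    refine ⟨?_, ?_, zero_mem _, by simp⟩
    · change E' (q j) ∈ Omega0 k x
      rw [hΩ0]
      exact Submodule.subset_span ⟨_, (hqT j).1, rfl⟩
    · change E' (q j) ∈ OmegaInf k x
      rw [hΩinf]
      exact Submodule.subset_span ⟨_, (hqT j).2, rfl⟩
  let v : J ⊕ J → cocycles k x := Sum.elim (fun j => ⟨a j, ha j⟩) (fun j => ⟨δ j, hδ' j⟩)
  let B := (coboundaries k x).submoduleOf (cocycles k x)
  have hsum : ∀ g : J ⊕ J → k, ((∑ j, g j • v j : cocycles k x) : Ω[F⁄k] × Ω[F⁄k] × F) =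
      ∑ j, g (Sum.inl j) • a j + ∑ j, g (Sum.inr j) • δ j := by
    intro g
    simp [v]
  have hli : LinearIndependent k fun j => B.mkQ (v j) := by
    rw [Fintype.linearIndependent_iff]
    intro g hg
    simp_rw [← map_smul, ← map_sum] at hg
    replace hg : ((∑ j, g j • v j : cocycles k x) : Ω[F⁄k] × Ω[F⁄k] × F) ∈ coboundaries k x :=
      (Submodule.Quotient.mk_eq_zero B).1 hg
    rw [hsum] at hg
    obtain ⟨f₀, hf₀, f₁, hf₁, hf⟩ := hg
    rw [← Subalgebra.mem_toSubmodule, hO0] at hf₀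
    rw [← Subalgebra.mem_toSubmodule, hOinf] at hf₁
    have h1 : ∑ j, g (Sum.inl j) • E (p j) = f₀ - f₁ := by
      have := congrArg (fun w : Ω[F⁄k] × Ω[F⁄k] × F => w.2.2) hf
      simpa [Prod.snd_sum, hδ, ha'] using this
    -- The left side of `h1` uses only monomials outside `S₀ ∪ S₁`, the right side only monomials
    -- inside it.
    have h2 : f₀ - f₁ = 0 := by
      have hdisj := hE.disjoint_span_image (s := Set.range p) (t := S₀ ∪ S₁)
        (by rw [hp']; exact disjoint_compl_left)
      refine Submodule.disjoint_def.1 hdisj _ ?_ ?_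
      · rw [← h1]
        exact Submodule.sum_mem _ fun j _ => Submodule.smul_mem _ _
          (Submodule.subset_span ⟨_, ⟨j, rfl⟩, rfl⟩)
      · exact Submodule.sub_mem _
          (Submodule.span_mono (Set.image_mono Set.subset_union_left) hf₀)
          (Submodule.span_mono (Set.image_mono Set.subset_union_right) hf₁)
    have h3 : ∀ j, g (Sum.inl j) = 0 :=
      Fintype.linearIndependent_iff.1 (hE.comp p hp) _ (h1.trans h2)
    -- Now f₀ = f₁ is regular on both open sets, hence a combination of monomials killed by d.
    have h4 : KaehlerDifferential.D k F f₀ = 0 := by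
      rw [← sub_eq_zero.1 h2] at hf₁
      have h5 : f₀ ∈ Submodule.span k (E '' (S₀ ∩ S₁)) := by
        rw [← span_image_inf_span_image hE]
        exact ⟨hf₀, hf₁⟩
      have h6 : Submodule.span k (E '' (S₀ ∩ S₁)) ≤
          LinearMap.ker (KaehlerDifferential.D k F).toLinearMap := by
        rw [Submodule.span_le]
        rintro _ ⟨i, hi, rfl⟩
        exact hconst i hi
      exact h6 h5
    have h5 : ∑ j, g (Sum.inr j) • E' (q j) = 0 := by
      have := congrArg (fun w : Ω[F⁄k] × Ω[F⁄k] × F => w.1) hf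
      simpa [Prod.fst_sum, hδ, h3, h4] using this
    have h6 : ∀ j, g (Sum.inr j) = 0 :=
      Fintype.linearIndependent_iff.1 (hE'.comp q hq) _ h5
    rintro (j | j)
    · exact h3 j
    · exact h6 j
  have hsp : ⊤ ≤ Submodule.span k (Set.range fun j => B.mkQ (v j)) := by
    intro z _
    obtain ⟨⟨⟨ω₀, ω₁, h⟩, hw⟩, rfl⟩ := B.mkQ_surjective z
    obtain ⟨h1, h2, h3, h4⟩ := id hw
    have h5 : h ∈ Submodule.span k (E '' S₀) ⊔ Submodule.span k (E '' S₁) ⊔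
        Submodule.span k (Set.range fun j => E (p j)) := by
      have hun : Set.range E = E '' S₀ ∪ E '' S₁ ∪ Set.range fun j => E (p j) := by
        rw [← Function.comp_def, Set.range_comp E p, hp', ← Set.image_union, ← Set.image_union,
          Set.union_compl_self, Set.image_univ]
      rw [← Submodule.span_union, ← Submodule.span_union, ← hun, ← hO0inf]
      exact h3
    obtain ⟨u, hu, c, hc, rfl⟩ := Submodule.mem_sup.1 h5
    obtain ⟨f₀, hf₀, f₁, hf₁, rfl⟩ := Submodule.mem_sup.1 hu
    obtain ⟨g, rfl⟩ := (Submodule.mem_span_range_iff_exists_fun k).1 hc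
    rw [← hO0] at hf₀
    rw [← hOinf] at hf₁
    have hbd : (KaehlerDifferential.D k F f₀, KaehlerDifferential.D k F (-f₁), f₀ - -f₁) ∈
        coboundaries k x := ⟨f₀, hf₀, -f₁, neg_mem (S := Subalgebra k F) hf₁, rfl⟩
    -- w removes from the cocycle its coboundary part and its a-part. Its function vanishes, so its
    -- two differentials agree and are globally regular.
    obtain ⟨w, hw'⟩ : ∃ w : Ω[F⁄k] × Ω[F⁄k] × F, w = (ω₀, ω₁, f₀ + f₁ + ∑ j, g j • E (p j)) -
      (KaehlerDifferential.D k F f₀, KaehlerDifferential.D k F (-f₁), f₀ - -f₁) -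
        ∑ j, g j • a j := ⟨_, rfl⟩
    have hwc : w ∈ cocycles k x := by
      rw [hw']
      exact sub_mem (sub_mem hw (coboundaries_le_cocycles k x hbd))
        (Submodule.sum_mem _ fun j _ => Submodule.smul_mem _ _ (ha j))
    have hw3 : w.2.2 = 0 := by
      rw [hw']
      simp [Prod.snd_sum, ha']
    obtain ⟨h6, h7, -, h8⟩ := hwc
    rw [hw3, map_zero, eq_comm, sub_eq_zero] at h8
    rw [← h8, hΩinf] at h7
    rw [hΩ0] at h6
    have h9 : w.1 ∈ Submodule.span k (Set.range fun j => E' (q j)) := by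
      rw [← Function.comp_def, Set.range_comp E' q, hq', ← span_image_inf_span_image hE']
      exact ⟨h6, h7⟩
    obtain ⟨g', hg'⟩ := (Submodule.mem_span_range_iff_exists_fun k).1 h9
    have h10 : w = ∑ j, g' j • δ j := by
      have h11 : w = (w.1, w.1, 0) := Prod.ext rfl (Prod.ext h8.symm hw3)
      rw [h11, ← hg']
      simp_rw [hδ]
      refine Prod.ext ?_ (Prod.ext ?_ ?_) <;> simp [Prod.fst_sum, Prod.snd_sum]
    have h11 : B.mkQ ⟨_, hw⟩ = ∑ j, Sum.elim g g' j • B.mkQ (v j) := by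
      simp_rw [← map_smul, ← map_sum]
      refine (Submodule.Quotient.eq B).2 ?_
      change _ - ((∑ j, Sum.elim g g' j • v j : cocycles k x) : Ω[F⁄k] × Ω[F⁄k] × F) ∈
        coboundaries k x
      rw [hsum]
      simp only [Sum.elim_inl, Sum.elim_inr]
      rw [← h10, hw']
      convert hbd using 1
      abel
    rw [h11]
    exact Submodule.sum_mem _ fun j _ => Submodule.smul_mem _ _ (Submodule.subset_span ⟨j, rfl⟩)
  refine ⟨hδ', Module.Basis.mk hli hsp, fun j => ?_, fun j => ?_⟩ <;> rw [Module.Basis.mk_apply] <;> rfl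

end Cech

/-! ### The explicit triples and their index set. -/

theorem truncLE_add_truncGT {k : Type*} [Field k] (h : k[X]) (m : ℕ) :
    truncLE h m + truncGT h m = h := by
  conv_rhs => rw [h.as_sum_support]
  rw [truncLE, truncGT, ← Finset.sum_filter_add_sum_filter_not h.support (· ≤ m)]
  simp only [not_le]

namespace IsKummer

variable {k F : Type*} [Field k] [Field F] [Algebra k F] {n r : ℕ} {ρ : Fin r → k} {l : Fin r → ℕ}
  {x y : F} (H : IsKummer n ρ l x y)
include H

theorem efun_mod (m : ℤ) (j : ℕ) : efun n ρ l x y (m, j % n) = efun n ρ l x y (m, j) := by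
  rw [efun, efun, H.wfun_mod]

theorem edif_mod (m : ℤ) (j : ℕ) : edif n ρ l x y (m, j % n) = edif n ρ l x y (m, j) := by
  rw [edif, edif, omegaOne_eq, omegaOne_eq, H.wfun_mod]

/-- Spanning families are indexed by all of ℕ, independent ones by `Fin n`; they agree since w_j and
t^{(j)} depend only on j mod n. -/
theorem image_fin {M : Type*} {f : ℤ × ℕ → M} (hf : ∀ m j, f (m, j % n) = f (m, j))
    (P : ℤ → ℕ → Prop) :
    f '' {q | P q.1 (tt n l q.2)} =
      (fun q : ℤ × Fin n => f (q.1, q.2)) '' {q | P q.1 (tt n l q.2)} := by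
  apply subset_antisymm
  · rintro _ ⟨⟨m, j⟩, hm, rfl⟩
    refine ⟨(m, ⟨j % n, Nat.mod_lt _ (Nat.pos_of_ne_zero H.ne_zero)⟩), ?_, hf m j⟩
    simp only [Set.mem_ofPred_eq, tt_mod] at hm ⊢
    exact hm
  · rintro _ ⟨⟨m, j⟩, hm, rfl⟩
    exact ⟨(m, j), hm, rfl⟩

/-- If t^{(j)} = 0 then all `υ_i` vanish, so w_j^n = 1 and w_j is a constant, contradicting its
independence from w_0 = 1. -/
theorem tt_pos (hE : LinearIndependent k fun q : ℤ × Fin n => efun n ρ l x y (q.1, q.2))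
    (hl : n ∣ ∑ i, l i) {j : ℕ} (hj : j < n) (hj0 : j ≠ 0) : tt n l j ≠ 0 := by
  intro h
  have h1 := mul_tt n l hl j
  rw [h, mul_zero, eq_comm, Finset.sum_eq_zero_iff] at h1
  have h2 : wfun n ρ l x y j ^ n = 1 := by
    rw [H.wfun_pow, prodPow, Finset.prod_eq_one, map_one]
    intro i hi
    rw [h1 i hi, pow_zero]
  obtain ⟨ζ, hζ, -⟩ := H.exists_algHom
  have : NeZero n := ⟨H.ne_zero⟩
  obtain ⟨i, -, hi⟩ := (hζ.map_of_injective (algebraMap k F).injective).eq_pow_of_pow_eq_one h2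
  have h3 := hE.eq_of_smul_apply_eq_smul_apply (1 : k) (ζ ^ i) (0, ⟨j, hj⟩) (0, 0) one_ne_zero (by
    simp [efun, wfun_zero, Algebra.smul_def, hi])
  exact hj0 (by simpa using congrArg (fun q : ℤ × Fin n => (q.2 : ℕ)) h3)

theorem monomial_smul_omegaOne (c : k) (i ν κ : ℕ) :
    (aeval x (monomial i c) / ((n : F) * x ^ (ν + 1))) • omegaOne n ρ l x y κ =
      ((n : k)⁻¹ * c) • edif n ρ l x y ((i : ℤ) - ν - 1, κ) := by
  rw [edif, ← smul_assoc]
  congr 1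
  have hx := H.x_ne_zero
  have hn := H.natCast_ne_zero
  rw [aeval_monomial, Algebra.smul_def, map_mul, map_inv₀, map_natCast, zpow_sub₀ hx, zpow_sub₀ hx,
    zpow_natCast, zpow_natCast, zpow_one]
  field_simp
  ring

theorem D_div {μ κ ν : ℕ} (hμ : n ∣ μ + κ) :
    KaehlerDifferential.D k F (y ^ μ / (x ^ ν * aeval x (gg n ρ l μ))) =
      (aeval x (psi n ρ l μ ν) / ((n : F) * x ^ (ν + 1))) • omegaOne n ρ l x y κ := by
  have hx := H.x_ne_zero
  have hn := H.natCast_ne_zero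
  have h1 : y ^ μ / (x ^ ν * aeval x (gg n ρ l μ)) = (x ^ ν)⁻¹ * wfun n ρ l x y μ := by
    rw [wfun, mul_comm (x ^ ν), ← div_div, div_eq_inv_mul (y ^ μ / _)]
  have h2 : wfun n ρ l x y μ • KaehlerDifferential.D k F (x ^ ν)⁻¹ =
      (-(x ^ ν)⁻¹ ^ 2 * ν * x ^ (ν - 1)) • aeval x (ramPoly ρ l n μ) • omegaOne n ρ l x y κ := by
    rw [← H.wfun_smul_D hμ, Derivation.leibniz_inv, Derivation.leibniz_pow,
      ← Nat.cast_smul_eq_nsmul F]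
    simp only [smul_smul]
    congr 1
    ring
  rw [h1, Derivation.leibniz, h2, H.D_wfun hμ, ← algebraMap_smul F (n : k)⁻¹, smul_smul, smul_smul,
    smul_smul, ← add_smul, map_inv₀, map_natCast, psi_eq, map_sub, map_mul, map_mul, aeval_X,
    aeval_C, map_natCast, Nat.cast_mul]
  congr 1
  -- The case ν = 0 is separate because of the truncated exponent `ν - 1`.
  rcases ν with _ | ν
  · simp
    field_simp
  · rw [Nat.add_sub_cancel]
    field_simp
    ring

end IsKummer

instance (n : ℕ) {r : ℕ} (l : Fin r → ℕ) : Finite (Idx n l) := by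
  let f : Idx n l → Σ j : Fin n, Fin (tt n l j) :=
    fun q => ⟨⟨q.1.1, q.2.1.2⟩, ⟨q.1.2, q.2.2.2.2⟩⟩
  refine Finite.of_injective f ?_
  rintro ⟨⟨μ, ν⟩, h⟩ ⟨⟨μ', ν'⟩, h'⟩ e
  simp only [f, Sigma.mk.injEq, Fin.mk.injEq] at e
  obtain ⟨rfl, e⟩ := e
  simp only [heq_eq_eq, Fin.mk.injEq] at e
  subst e
  rfl

end KummerCover

end

/-! ### Assembly of the basis. -/

theorem mainTheorem1 {k : Type*} [Field k] [IsAlgClosed k]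
    (n : ℕ) (hn : (n : k) ≠ 0)
    (r : ℕ) (ρ : Fin r → k) (hρ : Function.Injective ρ)
    (l : Fin r → ℕ) (hl : n ∣ ∑ i, l i)
    {F : Type*} [Field F] [Algebra k F] [Algebra (RatFunc k) F] [IsScalarTower k (RatFunc k) F]
    (x y : F) (hx : x = algebraMap (RatFunc k) F RatFunc.X)
    (hy : y ^ n = Polynomial.aeval x (KummerCover.ff ρ l))
    (hgen : IntermediateField.adjoin (RatFunc k) {y} = ⊤)
    (hdeg : Module.finrank (RatFunc k) F = n)
    (s : KummerCover.Idx n l → ℕ)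
    (hs : ∀ q, s q = q.1.2 ∨ (s q = q.1.2 + 1 ∧ 2 ≤ KummerCover.tt n l (n - q.1.1))) :
    ∃ (ha : ∀ q : KummerCover.Idx n l,
        KummerCover.aTriple n ρ l x y q.1.1 q.1.2 (s q) ∈ KummerCover.cocycles k x)
      (hδ : ∀ q : KummerCover.Idx n l,
        KummerCover.deltaTriple n ρ l x y q.1.1 q.1.2 ∈ KummerCover.cocycles k x)
      (b : Module.Basis (KummerCover.Idx n l ⊕ KummerCover.Idx n l) k (KummerCover.H1dR k x)),
      (∀ q, b (Sum.inl q) = KummerCover.cls k x _ (ha q)) ∧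
      (∀ q, b (Sum.inr q) = KummerCover.cls k x _ (hδ q)) := by
  open KummerCover in
  have H : IsKummer n ρ l x y := isKummer_of_finrank hn hρ hx hy hgen hdeg
  have hE := linearIndependent_efun H hx hgen hdeg
  have hE' := linearIndependent_edif H hx hgen hdeg (D_ne_zero hn hx hy hgen hdeg)
  obtain ⟨L, hL⟩ := id hl
  have hn0 : 0 < n := Nat.pos_of_ne_zero H.ne_zero
  have htt : ∀ j : ℕ, j < n → j ≠ 0 → tt n l j ≠ 0 := fun j => H.tt_pos hE hl
  have hO0 := H.regFun_inv_eq_span hL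
  have hO1 := H.regFun_eq_span
  have hO01 := H.regFun_inter_eq_span
  have hΩ0 := H.regDiff_inv_eq_span hL
  have hΩ1 := H.regDiff_eq_span
  have ha : ∀ q : Idx n l, aTriple n ρ l x y q.1.1 q.1.2 (s q) ∈ cocycles k x := by
    rintro ⟨⟨μ, ν⟩, ⟨hμ, hμn⟩, ht, hν, hνt⟩
    have hsq := hs ⟨⟨μ, ν⟩, ⟨hμ, hμn⟩, ht, hν, hνt⟩
    generalize s ⟨⟨μ, ν⟩, ⟨hμ, hμn⟩, ht, hν, hνt⟩ = m at hsq ⊢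
    -- t^{(n-μ)} ≥ 1 is what the cut s = ν needs on U_0; the cut s = ν + 1 needs t^{(n-μ)} ≥ 2,
    -- supplied by `hs`.
    have htκ := htt (n - μ) (by omega) (by omega)
    simp only at hμ hμn ht hν hνt hsq ⊢
    refine ⟨?_, ?_, ?_, ?_⟩
    · change _ ∈ regDiff k {x⁻¹}
      rw [hΩ0, aTriple, truncLE, map_sum, Finset.sum_div, Finset.sum_smul]
      refine Submodule.sum_mem _ fun i hi => ?_
      rw [H.monomial_smul_omegaOne]
      refine Submodule.smul_mem _ _ (Submodule.subset_span ⟨_, ?_, rfl⟩)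
      have := (Finset.mem_filter.1 hi).2
      simp only [Set.mem_ofPred_eq]
      omega
    · change _ ∈ regDiff k {x}
      rw [hΩ1, aTriple, truncGT, map_sum, Finset.sum_div, Finset.sum_smul]
      refine Submodule.neg_mem _ (Submodule.sum_mem _ fun i hi => ?_)
      rw [H.monomial_smul_omegaOne]
      refine Submodule.smul_mem _ _ (Submodule.subset_span ⟨_, ?_, rfl⟩)
      have := (Finset.mem_filter.1 hi).2
      simp only [Set.mem_ofPred_eq]
      omega
    · change _ ∈ Subalgebra.toSubmodule (regFun k {x, x⁻¹})
      rw [hO01]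
      refine Submodule.subset_span ⟨(-ν, μ), ?_⟩
      simp only [efun, aTriple, wfun, zpow_neg, zpow_natCast]
      rw [mul_comm (x ^ ν), ← div_div, div_eq_inv_mul (y ^ μ / _)]
    · rw [aTriple, H.D_div (κ := n - μ) (by rw [Nat.add_sub_cancel' hμn.le]), sub_neg_eq_add,
        ← add_smul, ← add_div, ← map_add, truncLE_add_truncGT]
  have e1 : ∀ P : ℤ → ℕ → Prop, _ := fun P => H.image_fin H.efun_mod P
  have e2 : ∀ P : ℤ → ℕ → Prop, _ := fun P => H.image_fin H.edif_mod P
  obtain ⟨hδ, b, hb⟩ := exists_basis_H1dR (x := x) hE hE'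
    (S₀ := {q | q.1 ≤ -(tt n l q.2 : ℤ)}) (S₁ := {q | 0 ≤ q.1})
    (T₀ := {q | q.1 ≤ (tt n l q.2 : ℤ) - 2}) (T₁ := {q | 0 ≤ q.1})
    (p := fun q : Idx n l => (-(q.1.2 : ℤ), ⟨q.1.1, q.2.1.2⟩))
    (q := fun q : Idx n l => ((q.1.2 : ℤ) - 1, ⟨q.1.1, q.2.1.2⟩))
    (a := fun q : Idx n l => aTriple n ρ l x y q.1.1 q.1.2 (s q))
    (δ := fun q : Idx n l => deltaTriple n ρ l x y q.1.1 q.1.2)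
    (hO0.trans (congrArg _ (e1 fun m t => m ≤ -(t : ℤ))))
    (hO1.trans (congrArg _ (e1 fun m _ => 0 ≤ m)))
    (hO01.trans (by
      have := e1 fun _ _ => True
      simp only [Set.ofPred_true, Set.image_univ] at this
      rw [this]))
    (hΩ0.trans (congrArg _ (e2 fun m t => m ≤ (t : ℤ) - 2)))
    (hΩ1.trans (congrArg _ (e2 fun m _ => 0 ≤ m)))
    (by
      rintro ⟨m, j, hj⟩ ⟨h1, h2⟩
      simp only [Set.mem_ofPred_eq] at h1 h2
      -- Being regular on both sides forces 0 ≤ m ≤ -t^{(j)}, so t^{(j)} = 0, j = 0 and m = 0: the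
      -- constant 1.
      have h3 := htt j hj
      obtain rfl : j = 0 := by
        by_contra h
        have := h3 h
        omega
      obtain rfl : m = 0 := by omega
      simp [efun, wfun_zero])
    (by
      rintro ⟨⟨μ, ν⟩, h⟩ ⟨⟨μ', ν'⟩, h'⟩ e
      simp only [Prod.mk.injEq, Fin.mk.injEq, neg_inj, Nat.cast_inj] at e
      obtain ⟨rfl, rfl⟩ := e
      rfl)
    (by
      rintro ⟨⟨μ, ν⟩, h⟩ ⟨⟨μ', ν'⟩, h'⟩ e
      simp only [Prod.mk.injEq, Fin.mk.injEq, sub_left_inj, Nat.cast_inj] at e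
      obtain ⟨rfl, rfl⟩ := e
      rfl)
    (by
      ext ⟨m, j, hj⟩
      simp only [Set.mem_range, Set.mem_compl_iff, Set.mem_union, Set.mem_ofPred_eq, not_or, not_le]
      constructor
      · rintro ⟨⟨⟨μ, ν⟩, h1, h2, h3, h4⟩, e⟩
        simp only [Prod.mk.injEq, Fin.mk.injEq] at e h1 h2 h3 h4
        obtain ⟨rfl, rfl⟩ := e
        omega
      · rintro ⟨h1, h2⟩
        have h0 : j ≠ 0 := by
          rintro rfl
          rw [tt_zero] at h1
          omega
        -- Here -t^{(j)} < m < 0, so ν = -m.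
        refine ⟨⟨⟨j, m.natAbs⟩, ?_⟩, ?_⟩
        · simp only
          omega
        · simp only [Prod.mk.injEq, and_true]
          omega)
    (by
      ext ⟨m, j, hj⟩
      simp only [Set.mem_range, Set.mem_inter_iff, Set.mem_ofPred_eq]
      constructor
      · rintro ⟨⟨⟨μ, ν⟩, h1, h2, h3, h4⟩, e⟩
        simp only [Prod.mk.injEq, Fin.mk.injEq] at e h1 h2 h3 h4
        obtain ⟨rfl, rfl⟩ := e
        omega
      · rintro ⟨h1, h2⟩
        have h0 : j ≠ 0 := by
          rintro rfl
          rw [tt_zero] at h1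
          omega
        -- Here 0 ≤ m ≤ t^{(j)} - 2, so ν = m + 1.
        refine ⟨⟨⟨j, m.natAbs + 1⟩, ?_⟩, ?_⟩
        · simp only
          omega
        · simp only [Prod.mk.injEq, and_true]
          omega)
    ha
    (by
      rintro ⟨⟨μ, ν⟩, h⟩
      simp only [efun, aTriple, wfun, zpow_neg, zpow_natCast]
      rw [mul_comm (x ^ ν), ← div_div, div_eq_inv_mul (y ^ μ / _)])
    (by
      rintro ⟨⟨μ, ν⟩, h1, h2, h3, h4⟩
      have h : x ^ (ν - 1) = x ^ ((ν : ℤ) - 1) := by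
        rw [← zpow_natCast, Nat.cast_sub h3, Nat.cast_one]
      simp only [deltaTriple, edif, h])
  exact ⟨ha, hδ, b, hb⟩
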